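/- **Theorem (Spectral Theorem: General Case).** Let $\mathbb{K}\in\{\mathbb{R},\mathbb{C}\}$, let $H$ be a Hilbert space over $\mathbb{K}$, let $d\in\mathbb{N}_0$, and let $A_1,\dots,A_d$ be (possibly unbounded) normal operators on $H$, i.e. each $A_j$ is a densely defined closed linear operator with $A_j^*A_j=A_jA_j^*$ (including equality of domains). If $\mathbb{K}=\mathbb{R}$, assume moreover that every $A_j$ is self-adjoint. For a densely defined closed operator $A$ put $T_A:=(1+A^*A)^{-1}$ and $S_A:=AT_A$, which are bounded operators on $H$, and assume that for all $j\neq k$ the operators $A_j$ and $A_k$ strongly commute, i.e. the bounded operators $T_{A_j},S_{A_j},T_{A_k},S_{A_k}$ commute pairwise. Then there is a unique Borel functional calculus $(\Phi,H)$ on $\mathbb{K}^d$ such that $\Phi(\mathbf{z}_j)=A_j$ for all $j=1,\dots,d$, where $\mathbf{z}_j:\mathbb{K}^d\to\mathbb{K}$ is the $j$-th coordinate function. Here a *Borel functional calculus* on $\mathbb{K}^d$ is a map $\Phi$ from the set of all Borel measurable functions $f:\mathbb{K}^d\to\mathbb{K}$ (bounded or not) to the set of closed linear operators in $H$ such that,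 for all such functions $f,g,f_n$ and all $\lambda\in\mathbb{K}$: 1. $\Phi(\mathbf{1})=\mathrm{I}$; 2. $\Phi(f)+\Phi(g)\subseteq\Phi(f+g)$ and $\lambda\Phi(f)\subseteq\Phi(\lambda f)$; 3. $\Phi(f)\Phi(g)\subseteq\Phi(fg)$ and $\operatorname{dom}(\Phi(f)\Phi(g))=\operatorname{dom}(\Phi(g))\cap\operatorname{dom}(\Phi(fg))$; 4. if $f$ is bounded, then $\Phi(f)$ is a bounded operator defined on all of $H$ and $\Phi(f)^*=\Phi(\overline{f})$; 5. if $f_n\to f$ pointwise and $\sup_n\|f_n\|_\infty<\infty$, then $\Phi(f_n)\to\Phi(f)$ weakly. (Sums and products of operators have their natural domains, and $\subseteq$ is inclusion of graphs.) -/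

import Mathlib

open Filter Topology

noncomputable section

namespace SpectralCalculus

section Operators

variable {𝕜 H : Type*} [RCLike 𝕜] [NormedAddCommGroup H] [InnerProductSpace 𝕜 H]

/-- The composition `T S` of two (unbounded) operators, on its natural domain
`{x ∈ dom S | S x ∈ dom T}`. -/
def opComp (T S : H →ₗ.[𝕜] H) : H →ₗ.[𝕜] H where
  domain := (T.domain.comap S.toFun).map S.domain.subtype
  toFun :=
    { toFun := fun x =>
        T ⟨S ⟨x.1, by obtain ⟨y, -, hy⟩ := x.2; exact hy ▸ y.2⟩, by
          obtain ⟨x, y, hy, rfl⟩ := x; exact hy⟩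
      map_add' := by
        rintro ⟨_, x, hx, rfl⟩ ⟨_, y, hy, rfl⟩
        rw [← T.map_add]
        congr 1
        exact Subtype.ext (S.map_add x y)
      map_smul' := by
        rintro c ⟨_, x, hx, rfl⟩
        rw [RingHom.id_apply, ← T.map_smul]
        congr 1
        exact Subtype.ext (S.map_smul c x) }

theorem mem_opComp_domain {T S : H →ₗ.[𝕜] H} {x : H} :
    x ∈ (opComp T S).domain ↔ ∃ h : x ∈ S.domain, S ⟨x, h⟩ ∈ T.domain := by
  constructor
  · rintro ⟨y, hy, rfl⟩
    exact ⟨y.2, hy⟩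
  · rintro ⟨h, h'⟩
    exact ⟨⟨x, h⟩, h', rfl⟩

theorem opComp_apply {T S : H →ₗ.[𝕜] H} {x : H} (h : x ∈ S.domain)
    (h' : S ⟨x, h⟩ ∈ T.domain) :
    opComp T S ⟨x, mem_opComp_domain.2 ⟨h, h'⟩⟩ = T ⟨S ⟨x, h⟩, h'⟩ := rfl

/-- A bounded operator, viewed as an operator with domain the whole space. -/
def ofBounded (B : H →L[𝕜] H) : H →ₗ.[𝕜] H := (B : H →ₗ[𝕜] H).toPMap ⊤

variable (𝕜 H) in
/-- The identity operator. -/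
def idOp : H →ₗ.[𝕜] H := ofBounded (ContinuousLinearMap.id 𝕜 H)

variable [CompleteSpace H]

/-- A (possibly unbounded) normal operator: densely defined, closed, and `A* A = A A*`
(including equality of domains). -/
structure IsNormalOp (A : H →ₗ.[𝕜] H) : Prop where
  dense_domain : Dense (A.domain : Set H)
  isClosed : A.IsClosed
  comm : opComp A.adjoint A = opComp A A.adjoint

/-- `T_A = (1 + A* A)⁻¹`. -/
def opT (A : H →ₗ.[𝕜] H) : H →ₗ.[𝕜] H :=
  (idOp 𝕜 H + opComp A.adjoint A).inverse

/-- `S_A = A T_A = A (1 + A* A)⁻¹`. -/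
def opS (A : H →ₗ.[𝕜] H) : H →ₗ.[𝕜] H :=
  opComp A (opT A)

/-- Strong commutativity: `T_A, S_A, T_B, S_B` commute pairwise. (For densely defined closed
operators these four operators are bounded and everywhere defined.) -/
def StronglyCommute (A B : H →ₗ.[𝕜] H) : Prop :=
  ∀ P ∈ ({opT A, opS A, opT B, opS B} : Set (H →ₗ.[𝕜] H)),
    ∀ Q ∈ ({opT A, opS A, opT B, opS B} : Set (H →ₗ.[𝕜] H)), opComp P Q = opComp Q P

end Operators

section Calculus

/-- The `𝕜`-valued measurable functions on `X`. -/
abbrev MeasFun (X 𝕜 : Type*) [MeasurableSpace X] [RCLike 𝕜] : Type _ :=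
  {f : X → 𝕜 // Measurable f}

/-- `Φ` is a measurable functional calculus on the measurable space `X`, on the Hilbert space `H`.
Inclusion of operators is inclusion of graphs, that is, `≤` on partially defined linear maps. -/
structure IsMeasurableCalculus {X 𝕜 H : Type*} [MeasurableSpace X] [RCLike 𝕜]
    [NormedAddCommGroup H] [InnerProductSpace 𝕜 H] [CompleteSpace H]
    (Φ : MeasFun X 𝕜 → H →ₗ.[𝕜] H) : Prop where
  /-- The values are closed operators. -/
  isClosed : ∀ f, (Φ f).IsClosed
  /-- `Φ(1) = I` -/
  map_one : Φ ⟨fun _ => 1, measurable_const⟩ = idOp 𝕜 H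
  /-- `Φ(f) + Φ(g) ⊆ Φ(f + g)` -/
  map_add_le : ∀ f g : MeasFun X 𝕜,
    Φ f + Φ g ≤ Φ ⟨fun x => f.1 x + g.1 x, f.2.add g.2⟩
  /-- `c Φ(f) ⊆ Φ(c f)` -/
  map_smul_le : ∀ (c : 𝕜) (f : MeasFun X 𝕜),
    c • Φ f ≤ Φ ⟨fun x => c * f.1 x, f.2.const_mul c⟩
  /-- `Φ(f) Φ(g) ⊆ Φ(f g)` -/
  map_mul_le : ∀ f g : MeasFun X 𝕜,
    opComp (Φ f) (Φ g) ≤ Φ ⟨fun x => f.1 x * g.1 x, f.2.mul g.2⟩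
  /-- `dom(Φ(f) Φ(g)) = dom(Φ(g)) ∩ dom(Φ(f g))` -/
  domain_mul : ∀ f g : MeasFun X 𝕜,
    (opComp (Φ f) (Φ g)).domain =
      (Φ g).domain ⊓ (Φ ⟨fun x => f.1 x * g.1 x, f.2.mul g.2⟩).domain
  /-- If `f` is bounded, then `Φ(f)` is a bounded operator on `H`, with adjoint `Φ(conj f)`. -/
  map_bounded : ∀ f : MeasFun X 𝕜, (∃ C : ℝ, ∀ x, ‖f.1 x‖ ≤ C) →
    ∃ B : H →L[𝕜] H, Φ f = ofBounded B ∧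
      Φ ⟨fun x => (starRingEnd 𝕜) (f.1 x), RCLike.continuous_conj.measurable.comp f.2⟩ =
        ofBounded (ContinuousLinearMap.adjoint B)
  /-- If `f n → g` boundedly and pointwise, then the bounded operators `Φ(f n)` converge
  weakly to the bounded operator `Φ(g)`. -/
  weak_bp_continuous : ∀ (f : ℕ → MeasFun X 𝕜) (g : MeasFun X 𝕜),
    (∃ C : ℝ, ∀ n x, ‖(f n).1 x‖ ≤ C) →
    (∀ x, Tendsto (fun n => (f n).1 x) atTop (𝓝 (g.1 x))) →
    ∀ (B : ℕ → H →L[𝕜] H) (L : H →L[𝕜] H),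
      (∀ n, Φ (f n) = ofBounded (B n)) → Φ g = ofBounded L →
      ∀ u v : H, Tendsto (fun n => inner 𝕜 v (B n u)) atTop (𝓝 (inner 𝕜 v (L u)))

/-- The coordinate function `z_j : 𝕜^d → 𝕜`. -/
def coord (𝕜 : Type*) [RCLike 𝕜] {d : ℕ} (j : Fin d) : MeasFun (Fin d → 𝕜) 𝕜 :=
  ⟨fun z => z j, measurable_pi_apply j⟩

end Calculus

end SpectralCalculus

end

noncomputable section

namespace SpectralCalculus

/-! ### Operators handled through their graphs -/

section Graphs

variable {𝕜 H : Type*} [RCLike 𝕜] [NormedAddCommGroup H] [InnerProductSpace 𝕜 H]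

/-! Existence. The bounded transform (T, S) = ((1 + A*A)⁻¹, A T) replaces each A by bounded
operators. Normality of A makes T self-adjoint and S normal, commuting with T; strong commutativity
together with Fuglede's theorem makes the closed star algebra generated by all T_j, S_j commutative.
Gelfand theory identifies this algebra with C(K), K compact metrizable. It is derived here from
states, so that the real case is covered too: extreme states are multiplicative
(`extremePoints_stateSpace_subset`), and Krein–Milman makes the Gelfand transform isometric
(`norm_le_of_forall_char`).

The inverse representation ρ of C(K) yields, by Riesz–Markov, a measure μ_x for every vector x with
‖ρ(f)x‖² = ∫ |f|² dμ_x. Hence f ↦ ρ(f)x extends to an isometry L²(μ_x) → H, and Φ(f)x is defined as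
its value at f exactly when f ∈ L²(μ_x). Identities for continuous f pass to measurable f by L²
approximation. Since T is injective and its range is a core of A, the calculus satisfies Φ(s/t) = A
whenever Φ(t) = T and Φ(s) = S (`eq_of_isBoundedTransform`); pushing it forward along (s_j/t_j)_j
gives a calculus on 𝕜^d.

Uniqueness. In any calculus with Φ(z) = A, the functions 1/(1+|z|²) and z/(1+|z|²) must go to T and
S (`eq_boundedTransform`). They embed 𝕜^d into a compact ball, where Stone–Weierstrass, the π-λ
theorem and truncation show that two calculi agreeing on the coordinates coincide
(`eq_of_separating`). -/

theorem inner_eq_inner_symm {a b c d : H} (h : inner 𝕜 a b = inner 𝕜 c d) :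
    inner 𝕜 b a = inner 𝕜 d c := by
  rw [← inner_conj_symm, h, inner_conj_symm]

theorem mem_graph_opComp {T S : H →ₗ.[𝕜] H} {x y : H} :
    (x, y) ∈ (opComp T S).graph ↔ ∃ z, (x, z) ∈ S.graph ∧ (z, y) ∈ T.graph := by
  constructor
  · intro h
    obtain ⟨⟨x', hx'⟩, h1, h2⟩ := LinearPMap.mem_graph_iff _ |>.1 h
    obtain ⟨hS, hT⟩ := mem_opComp_domain.1 hx'
    simp only at h1 h2
    subst h1
    refine ⟨S ⟨x', hS⟩, S.mem_graph ⟨x', hS⟩, ?_⟩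
    rw [opComp_apply hS hT] at h2
    rw [← h2]
    exact T.mem_graph ⟨_, hT⟩
  · rintro ⟨z, h1, h2⟩
    obtain ⟨⟨x', hS⟩, rfl, h1⟩ := LinearPMap.mem_graph_iff _ |>.1 h1
    simp only at h1
    subst h1
    obtain ⟨⟨z', hT⟩, h3, h2⟩ := LinearPMap.mem_graph_iff _ |>.1 h2
    simp only at h3 h2
    subst h3
    rw [← h2, ← opComp_apply hS hT]
    exact (opComp T S).mem_graph ⟨x', mem_opComp_domain.2 ⟨hS, hT⟩⟩

theorem mem_graph_ofBounded {B : H →L[𝕜] H} {x y : H} :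
    (x, y) ∈ (ofBounded B).graph ↔ y = B x := by
  rw [LinearPMap.mem_graph_iff]
  constructor
  · rintro ⟨z, rfl, h⟩
    exact h.symm
  · rintro rfl
    exact ⟨⟨x, trivial⟩, rfl, rfl⟩

theorem mem_graph_idOp {x y : H} : (x, y) ∈ (idOp 𝕜 H).graph ↔ y = x :=
  mem_graph_ofBounded

theorem mem_graph_add {S T : H →ₗ.[𝕜] H} {x y : H} :
    (x, y) ∈ (S + T).graph ↔ ∃ u v, (x, u) ∈ S.graph ∧ (x, v) ∈ T.graph ∧ y = u + v := by
  simp only [LinearPMap.mem_graph_iff]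
  constructor
  · rintro ⟨⟨z, hz⟩, rfl, rfl⟩
    exact ⟨_, _, ⟨⟨z, hz.1⟩, rfl, rfl⟩, ⟨⟨z, hz.2⟩, rfl, rfl⟩, rfl⟩
  · rintro ⟨u, v, ⟨⟨z, hz⟩, rfl, rfl⟩, ⟨⟨z', hz'⟩, h, rfl⟩, rfl⟩
    simp only at h
    subst h
    exact ⟨⟨z', hz, hz'⟩, rfl, rfl⟩

theorem mem_graph_smul {T : H →ₗ.[𝕜] H} {c : 𝕜} {x y : H} :
    (x, y) ∈ (c • T).graph ↔ ∃ z, (x, z) ∈ T.graph ∧ y = c • z := by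
  rw [LinearPMap.smul_graph, Submodule.mem_map]
  constructor
  · rintro ⟨⟨a, b⟩, h, h'⟩
    simp only [LinearMap.prodMap_apply, LinearMap.id_coe, id, LinearMap.smul_apply,
      Prod.mk_inj] at h'
    obtain ⟨rfl, rfl⟩ := h'
    exact ⟨b, h, rfl⟩
  · rintro ⟨z, h, rfl⟩
    exact ⟨(x, z), h, rfl⟩

theorem le_of_forall_mem_graph {S T : H →ₗ.[𝕜] H}
    (h : ∀ x y, (x, y) ∈ S.graph → (x, y) ∈ T.graph) : S ≤ T :=
  LinearPMap.le_of_le_graph fun p hp => h p.1 p.2 hp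

theorem eq_of_forall_mem_graph {S T : H →ₗ.[𝕜] H}
    (h : ∀ x y, (x, y) ∈ S.graph ↔ (x, y) ∈ T.graph) : S = T :=
  le_antisymm (le_of_forall_mem_graph fun x y => (h x y).1)
    (le_of_forall_mem_graph fun x y => (h x y).2)

theorem mem_graph_of_le {S T : H →ₗ.[𝕜] H} (h : S ≤ T) {x y : H} (hx : (x, y) ∈ S.graph) :
    (x, y) ∈ T.graph :=
  LinearPMap.le_graph_of_le h hx

theorem ofBounded_injective : Function.Injective (ofBounded : (H →L[𝕜] H) → H →ₗ.[𝕜] H) := by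
  intro B C h
  ext x
  have : (x, B x) ∈ (ofBounded C).graph := h ▸ mem_graph_ofBounded.2 rfl
  exact mem_graph_ofBounded.1 this

theorem opComp_ofBounded (B C : H →L[𝕜] H) :
    opComp (ofBounded B) (ofBounded C) = ofBounded (B * C) := by
  refine eq_of_forall_mem_graph fun x y => ?_
  simp [mem_graph_opComp, mem_graph_ofBounded, -LinearPMap.mem_graph_iff]

/-- A sequence in the graph of a closed operator can only converge inside the graph. -/
theorem mem_graph_of_tendsto {A : H →ₗ.[𝕜] H} (hA : A.IsClosed) {u v : ℕ → H} {x y : H}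
    (h : ∀ n, (u n, v n) ∈ A.graph) (hu : Tendsto u atTop (𝓝 x)) (hv : Tendsto v atTop (𝓝 y)) :
    (x, y) ∈ A.graph :=
  IsClosed.mem_of_tendsto hA (hu.prodMk_nhds hv) (Eventually.of_forall h)

variable [CompleteSpace H]

theorem mem_graph_adjoint {A : H →ₗ.[𝕜] H} (hA : Dense (A.domain : Set H)) {y z : H} :
    (y, z) ∈ A.adjoint.graph ↔ ∀ a b, (a, b) ∈ A.graph → inner 𝕜 b y = inner 𝕜 a z := by
  rw [LinearPMap.adjoint_graph_eq_graph_adjoint hA, Submodule.mem_adjoint_iff]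
  simp only [sub_eq_zero]

end Graphs

/-! ### The bounded transform of a closed operator -/

section BoundedTransform

variable {𝕜 H : Type*} [RCLike 𝕜] [NormedAddCommGroup H] [InnerProductSpace 𝕜 H]
  [CompleteSpace H]

/-- `T = (1 + A* A)⁻¹` and `S = A T`, expressed through graphs. -/
structure IsBoundedTransform (A : H →ₗ.[𝕜] H) (T S : H →L[𝕜] H) : Prop where
  dense_domain : Dense (A.domain : Set H)
  isClosed : A.IsClosed
  mem_graph : ∀ x, (T x, S x) ∈ A.graph
  mem_graph_adjoint : ∀ x, (S x, x - T x) ∈ A.adjoint.graph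

/-- The orthogonal projection of (x, 0) onto the closed graph of A is (Tx, Sx); that the residual (x
- Tx, -Sx) is orthogonal to the graph says exactly A*Sx = x - Tx. The product carries the L² norm to
make it a Hilbert space. -/
theorem exists_isBoundedTransform {A : H →ₗ.[𝕜] H} (hd : Dense (A.domain : Set H))
    (hc : A.IsClosed) : ∃ T S : H →L[𝕜] H, IsBoundedTransform A T S := by
  let e : WithLp 2 (H × H) ≃L[𝕜] H × H := WithLp.prodContinuousLinearEquiv 2 𝕜 H H
  let G : Submodule 𝕜 (WithLp 2 (H × H)) := A.graph.comap (e : WithLp 2 (H × H) →ₗ[𝕜] H × H)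
  have hG : IsClosed (G : Set (WithLp 2 (H × H))) := IsClosed.preimage e.continuous hc
  have : CompleteSpace G := hG.completeSpace_coe
  let P : H →L[𝕜] H × H :=
    (e : WithLp 2 (H × H) →L[𝕜] H × H) ∘L G.starProjection ∘L
      (e.symm : H × H →L[𝕜] WithLp 2 (H × H)) ∘L ContinuousLinearMap.inl 𝕜 H H
  refine ⟨ContinuousLinearMap.fst 𝕜 H H ∘L P, ContinuousLinearMap.snd 𝕜 H H ∘L P, hd, hc,
    fun x => ?_, fun x => ?_⟩
  · exact G.starProjection_apply_mem (e.symm (x, 0))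
  · rw [SpectralCalculus.mem_graph_adjoint hd]
    intro a b hab
    have h1 : e.symm (x, 0) - G.starProjection (e.symm (x, 0)) ∈ Gᗮ :=
      Submodule.sub_starProjection_mem_orthogonal _
    have h2 := (Submodule.mem_orthogonal _ _).1 h1 (e.symm (a, b))
      (show e (e.symm (a, b)) ∈ A.graph by simpa using hab)
    rw [WithLp.prod_inner_apply] at h2
    change inner 𝕜 a (x - (P x).1) + inner 𝕜 b (0 - (P x).2) = 0 at h2
    rw [zero_sub, inner_neg_right, ← sub_eq_add_neg, sub_eq_zero] at h2
    exact h2.symm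

namespace IsBoundedTransform

variable {A : H →ₗ.[𝕜] H} {T S : H →L[𝕜] H} (h : IsBoundedTransform A T S)
include h

/-- Subtracting two solutions of v = Au, w = A*v with the same u + w and pairing gives ‖v - S(u +
w)‖² = -‖u - T(u + w)‖², so both vanish. Thus T inverts 1 + A*A. -/
theorem unique {u v w : H} (h1 : (u, v) ∈ A.graph) (h2 : (v, w) ∈ A.adjoint.graph) :
    u = T (u + w) ∧ v = S (u + w) := by
  have h3 := A.graph.sub_mem h1 (h.mem_graph (u + w))
  have h4 := A.adjoint.graph.sub_mem h2 (h.mem_graph_adjoint (u + w))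
  simp only [Prod.mk_sub_mk] at h3 h4
  have h5 := (SpectralCalculus.mem_graph_adjoint h.dense_domain).1 h4 _ _ h3
  have h6 : w - (u + w - T (u + w)) = -(u - T (u + w)) := by abel
  rw [h6, inner_neg_right, inner_self_eq_norm_sq_to_K, inner_self_eq_norm_sq_to_K] at h5
  have h7 : ‖v - S (u + w)‖ ^ 2 = -‖u - T (u + w)‖ ^ 2 := by exact_mod_cast h5
  have h8 : ‖v - S (u + w)‖ = 0 := by nlinarith [sq_nonneg ‖u - T (u + w)‖]
  have h9 : ‖u - T (u + w)‖ = 0 := by nlinarith [sq_nonneg ‖v - S (u + w)‖]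
  exact ⟨sub_eq_zero.1 (norm_eq_zero.1 h9), sub_eq_zero.1 (norm_eq_zero.1 h8)⟩

theorem opT_eq : opT A = ofBounded T := by
  have key : ∀ u x : H, (u, x) ∈ (idOp 𝕜 H + opComp A.adjoint A).graph ↔ u = T x := by
    intro u x
    simp only [mem_graph_add, mem_graph_idOp, mem_graph_opComp]
    constructor
    · rintro ⟨_, w, rfl, ⟨v, h1, h2⟩, rfl⟩
      exact (h.unique h1 h2).1
    · rintro rfl
      exact ⟨_, _, rfl, ⟨S x, h.mem_graph x, h.mem_graph_adjoint x⟩, by abel⟩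
  have hker : LinearMap.ker (idOp 𝕜 H + opComp A.adjoint A).toFun = ⊥ := by
    rw [LinearMap.ker_eq_bot']
    intro m hm
    have := (key m 0).1 ((LinearPMap.mem_graph_iff _).2 ⟨m, rfl, hm⟩)
    exact Subtype.ext (by simpa using this)
  refine eq_of_forall_mem_graph fun x y => ?_
  rw [opT, LinearPMap.inverse_graph hker, mem_graph_ofBounded, ← key, Submodule.mem_map]
  constructor
  · rintro ⟨⟨a, b⟩, hab, h'⟩
    obtain ⟨rfl, rfl⟩ := Prod.mk_inj.1 h'
    exact hab
  · exact fun h' => ⟨(y, x), h', rfl⟩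

theorem opS_eq : opS A = ofBounded S := by
  refine eq_of_forall_mem_graph fun x y => ?_
  rw [opS, h.opT_eq, mem_graph_opComp, mem_graph_ofBounded]
  constructor
  · rintro ⟨z, hz, hy⟩
    rw [mem_graph_ofBounded.1 hz] at hy
    exact A.mem_graph_snd_inj hy (h.mem_graph x) rfl
  · rintro rfl
    exact ⟨T x, mem_graph_ofBounded.2 rfl, h.mem_graph x⟩

/-- The right-hand side is Hermitian in x and y, which makes T self-adjoint. -/
theorem inner_left (x y : H) :
    inner 𝕜 (T x) y = inner 𝕜 (T x) (T y) + inner 𝕜 (S x) (S y) := by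
  have := (SpectralCalculus.mem_graph_adjoint h.dense_domain).1 (h.mem_graph_adjoint y) _ _
    (h.mem_graph x)
  rw [this, inner_sub_right]
  ring

theorem isSelfAdjoint_left : IsSelfAdjoint T := by
  rw [ContinuousLinearMap.isSelfAdjoint_iff_isSymmetric]
  intro x y
  change inner 𝕜 (T x) y = inner 𝕜 x (T y)
  rw [← inner_conj_symm x, h.inner_left x y, h.inner_left y x, map_add, inner_conj_symm,
    inner_conj_symm]

theorem injective : Function.Injective T := by
  rw [injective_iff_map_eq_zero]
  intro x hx
  have h1 := h.mem_graph x
  rw [hx] at h1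
  have h2 := A.graph_fst_eq_zero_snd h1 rfl
  have h3 := h.mem_graph_adjoint x
  rw [h2, hx, sub_zero] at h3
  exact A.adjoint.graph_fst_eq_zero_snd h3 rfl

/-- The range of `T` is a core of `A`. -/
theorem le_of_isClosed {B : H →ₗ.[𝕜] H} (hB : B.IsClosed)
    (hTS : ∀ x, (T x, S x) ∈ B.graph) : A ≤ B := by
  let e : WithLp 2 (H × H) ≃L[𝕜] H × H := WithLp.prodContinuousLinearEquiv 2 𝕜 H H
  let M : Submodule 𝕜 (WithLp 2 (H × H)) :=
    (A.graph ⊓ B.graph).comap (e : WithLp 2 (H × H) →ₗ[𝕜] H × H)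
  have hM : IsClosed (M : Set (WithLp 2 (H × H))) :=
    IsClosed.preimage e.continuous (h.isClosed.inter hB)
  have : CompleteSpace M := hM.completeSpace_coe
  refine le_of_forall_mem_graph fun a b hab => ?_
  set p := M.starProjection (e.symm (a, b)) with hp
  have hpM : e p ∈ A.graph ⊓ B.graph := M.starProjection_apply_mem (e.symm (a, b))
  have horth : e.symm (a, b) - p ∈ Mᗮ := Submodule.sub_starProjection_mem_orthogonal _
  have hd := A.graph.sub_mem hab hpM.1
  obtain ⟨u, v, huv⟩ : ∃ u v, (u, v) = (a, b) - e p := ⟨_, _, rfl⟩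
  rw [← huv] at hd
  -- The residual (u, v) lies in the graph of A and is orthogonal to every (Tx, Sx). Since A*Sx = x
  -- - Tx, this orthogonality reads ⟨Tx, u⟩ + ⟨x - Tx, u⟩ = ⟨x, u⟩ = 0.
  have hu : u = 0 := by
    refine ext_inner_left 𝕜 fun x => ?_
    have h2 := (Submodule.mem_orthogonal _ _).1 horth (e.symm (T x, S x))
      (show e (e.symm (T x, S x)) ∈ A.graph ⊓ B.graph by
        rw [e.apply_symm_apply]; exact ⟨h.mem_graph x, hTS x⟩)
    rw [WithLp.prod_inner_apply] at h2
    have h3 : e (e.symm (a, b) - p) = (u, v) := by rw [huv, map_sub, e.apply_symm_apply]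
    change inner 𝕜 (T x) (e (e.symm (a, b) - p)).1 + inner 𝕜 (S x) (e (e.symm (a, b) - p)).2 = 0
      at h2
    rw [h3] at h2
    have h4 := (SpectralCalculus.mem_graph_adjoint h.dense_domain).1 (h.mem_graph_adjoint x) _ _ hd
    rw [inner_eq_inner_symm h4, ← inner_add_left, add_sub_cancel] at h2
    rw [h2, inner_zero_right]
  subst hu
  have hv := A.graph_fst_eq_zero_snd hd rfl
  subst hv
  have : (a, b) = e p := sub_eq_zero.1 huv.symm
  rw [this]
  exact hpM.2

/-- Passing to adjoints in A*T = S* gives T A ⊆ S. -/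
theorem apply_graph (hT : ∀ x, (T x, ContinuousLinearMap.adjoint S x) ∈ A.adjoint.graph)
    {a b : H} (hab : (a, b) ∈ A.graph) : S a = T b := by
  refine ext_inner_left 𝕜 fun z => ?_
  have h1 := (SpectralCalculus.mem_graph_adjoint h.dense_domain).1 (hT z) _ _ hab
  have h2 := ContinuousLinearMap.isSelfAdjoint_iff_isSymmetric.1 h.isSelfAdjoint_left z b
  change inner 𝕜 (T z) b = inner 𝕜 z (T b) at h2
  rw [← h2, inner_eq_inner_symm h1, ContinuousLinearMap.adjoint_inner_left]

/-- Passing to adjoints in A T = S gives T A* ⊆ S*. -/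
theorem apply_graph_adjoint {a b : H} (hab : (a, b) ∈ A.adjoint.graph) :
    ContinuousLinearMap.adjoint S a = T b := by
  refine ext_inner_left 𝕜 fun z => ?_
  have h1 := (SpectralCalculus.mem_graph_adjoint h.dense_domain).1 hab _ _ (h.mem_graph z)
  have h2 := ContinuousLinearMap.isSelfAdjoint_iff_isSymmetric.1 h.isSelfAdjoint_left z b
  change inner 𝕜 (T z) b = inner 𝕜 z (T b) at h2
  rw [← h2, ← h1, ContinuousLinearMap.adjoint_inner_right]

/-- Because A*A = AA*, the vector w = A*Tx exists and Aw = x - Tx; pairing w with an arbitrary y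
identifies it as S*x. So the bounded transform of A* is (T, S*). -/
theorem mem_graph_adjoint_of_normal (hn : IsNormalOp A) (x : H) :
    (T x, ContinuousLinearMap.adjoint S x) ∈ A.adjoint.graph ∧
      (ContinuousLinearMap.adjoint S x, x - T x) ∈ A.graph := by
  have h1 : (T x, x - T x) ∈ (opComp A.adjoint A).graph :=
    mem_graph_opComp.2 ⟨S x, h.mem_graph x, h.mem_graph_adjoint x⟩
  rw [hn.comm] at h1
  obtain ⟨w, hw1, hw2⟩ := mem_graph_opComp.1 h1
  have key : ContinuousLinearMap.adjoint S x = w := by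
    refine ext_inner_left 𝕜 fun y => ?_
    rw [ContinuousLinearMap.adjoint_inner_right]
    have e1 := (SpectralCalculus.mem_graph_adjoint h.dense_domain).1 hw1 _ _ (h.mem_graph y)
    have e2 := (SpectralCalculus.mem_graph_adjoint h.dense_domain).1 (h.mem_graph_adjoint y) _ _ hw2
    have e3 := inner_eq_inner_symm e2
    rw [show inner 𝕜 (S y) x = inner 𝕜 (S y) (T x) + inner 𝕜 (S y) (x - T x) by
      rw [← inner_add_right]; congr 1; abel, e1, e3, ← inner_add_left]
    congr 1; abel
  rw [key]
  exact ⟨hw1, hw2⟩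

theorem commute_of_normal (hn : IsNormalOp A) : Commute T S := by
  ext x
  exact (h.apply_graph (fun y => (h.mem_graph_adjoint_of_normal hn y).1) (h.mem_graph x)).symm

/-- Both S*S and SS* equal T(1 - T), by the inclusions T A* ⊆ S* and T A ⊆ S. -/
theorem isStarNormal (hn : IsNormalOp A) : IsStarNormal S := by
  constructor
  ext x
  change ContinuousLinearMap.adjoint S (S x) = S (ContinuousLinearMap.adjoint S x)
  rw [h.apply_graph (fun y => (h.mem_graph_adjoint_of_normal hn y).1)
    (h.mem_graph_adjoint_of_normal hn x).2, h.apply_graph_adjoint (h.mem_graph_adjoint x)]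

theorem isSelfAdjoint_right (hn : IsNormalOp A) (hs : IsSelfAdjoint A) : IsSelfAdjoint S := by
  refine ContinuousLinearMap.ext fun x => ?_
  have h1 := (h.mem_graph_adjoint_of_normal hn x).1
  rw [LinearPMap.isSelfAdjoint_def.1 hs] at h1
  exact A.mem_graph_snd_inj h1 (h.mem_graph x) rfl

end IsBoundedTransform

theorem StronglyCommute.commute {A B : H →ₗ.[𝕜] H} (hAB : StronglyCommute A B)
    {T S T' S' : H →L[𝕜] H} (h : IsBoundedTransform A T S) (h' : IsBoundedTransform B T' S') :
    Commute T T' ∧ Commute T S' ∧ Commute S T' ∧ Commute S S' := by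
  simp only [StronglyCommute, h.opT_eq, h.opS_eq, h'.opT_eq, h'.opS_eq] at hAB
  have key : ∀ P Q : H →L[𝕜] H,
      opComp (ofBounded P) (ofBounded Q) = opComp (ofBounded Q) (ofBounded P) → Commute P Q := by
    intro P Q hPQ
    rw [opComp_ofBounded, opComp_ofBounded] at hPQ
    exact ofBounded_injective hPQ
  refine ⟨key _ _ (hAB _ ?_ _ ?_), key _ _ (hAB _ ?_ _ ?_), key _ _ (hAB _ ?_ _ ?_),
    key _ _ (hAB _ ?_ _ ?_)⟩ <;> simp

end BoundedTransform

/-! ### Fuglede's theorem over both scalar fields -/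

section Fuglede

/-- **Fuglede's theorem** over `ℝ` or `ℂ`; over `ℝ` only self-adjoint operators are allowed. -/
theorem commute_adjoint_of_commute {𝕜 H : Type*} [RCLike 𝕜] [NormedAddCommGroup H]
    [InnerProductSpace 𝕜 H] [CompleteSpace H] {N B : H →L[𝕜] H} (hN : IsStarNormal N)
    (hreal : (RCLike.I : 𝕜) = 0 → IsSelfAdjoint N) (h : Commute N B) : Commute (star N) B := by
  by_cases hI : (RCLike.I : 𝕜) = 0
  · rwa [(hreal hI).star_eq]
  · have him : RCLike.im (RCLike.I : 𝕜) = 1 := RCLike.I_eq_zero_or_im_I_eq_one.resolve_left hI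
    -- When I ≠ 0 the field 𝕜 is isometrically ℂ. Transporting scalars along `e` turns the operators
    -- into a complex C*-algebra, where the usual Fuglede theorem applies.
    let e : ℂ →+* 𝕜 := (RCLike.complexRingEquiv him).symm.toRingHom
    have he : ∀ c : ℂ, e c = (c.re : 𝕜) + (c.im : 𝕜) * RCLike.I := fun c => rfl
    have hnorm : ∀ c : ℂ, ‖e c‖ = ‖c‖ := (RCLike.complexLinearIsometryEquiv him).symm.norm_map
    have hstar : ∀ c : ℂ, e (star c) = star (e c) := by
      intro c
      simp [he]
    let i1 : Algebra ℂ (H →L[𝕜] H) := Algebra.compHom (H →L[𝕜] H) e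
    have hsmul : ∀ (c : ℂ) (a : H →L[𝕜] H), c • a = e c • a := fun _ _ => rfl
    let i2 : NormedAlgebra ℂ (H →L[𝕜] H) :=
      { i1 with norm_smul_le := fun c a => by rw [hsmul, norm_smul, hnorm] }
    have i3 : StarModule ℂ (H →L[𝕜] H) :=
      ⟨fun c a => by rw [hsmul, hsmul, star_smul, hstar]⟩
    let i4 : CStarAlgebra (H →L[𝕜] H) := {}
    exact hN.commute_star_left h

end Fuglede

/-! ### Products of commuting positive operators -/

section PositiveProduct

variable {𝕜 H : Type*} [RCLike 𝕜] [NormedAddCommGroup H] [InnerProductSpace 𝕜 H]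
  [CompleteSpace H]

theorem isPositive_mul_mul_self {P Q : H →L[𝕜] H} (hP : IsSelfAdjoint P) (hQ : Q.IsPositive) :
    (P * Q * P).IsPositive := by
  have := hQ.conj_adjoint P
  rw [← ContinuousLinearMap.star_eq_adjoint, hP.star_eq] at this
  exact this

/-- The iteration `P ↦ P - P ^ 2`. -/
def subSqIter (P : H →L[𝕜] H) : ℕ → H →L[𝕜] H
  | 0 => P
  | n + 1 => subSqIter P n - subSqIter P n * subSqIter P n

/-- The bounds 0 ≤ R ≤ 1 persist because R - R² = R(1-R)R + (1-R)R(1-R) and 1 - (R - R²) = (1-R) +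
R². -/
theorem subSqIter_isPositive {P : H →L[𝕜] H} (hP : P.IsPositive) (hP1 : (1 - P).IsPositive) (n : ℕ) :
    (subSqIter P n).IsPositive ∧ (1 - subSqIter P n).IsPositive := by
  induction n with
  | zero => exact ⟨hP, hP1⟩
  | succ n ih =>
    obtain ⟨h0, h1⟩ := ih
    set R := subSqIter P n with hR
    have e1 : subSqIter P (n + 1) = R * (1 - R) * R + (1 - R) * R * (1 - R) := by
      change R - R * R = _
      noncomm_ring
    have e2 : 1 - subSqIter P (n + 1) = (1 - R) + R * 1 * R := by
      change 1 - (R - R * R) = _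
      noncomm_ring
    rw [e2, e1]
    exact ⟨(isPositive_mul_mul_self h0.isSelfAdjoint h1).add
      (isPositive_mul_mul_self h1.isSelfAdjoint h0),
      h1.add (isPositive_mul_mul_self h0.isSelfAdjoint ContinuousLinearMap.isPositive_one)⟩

omit [CompleteSpace H] in
theorem subSqIter_commute {P Q : H →L[𝕜] H} (h : Commute Q P) (n : ℕ) :
    Commute Q (subSqIter P n) := by
  induction n with
  | zero => exact h
  | succ n ih => exact ih.sub_right (ih.mul_right ih)

/-- Telescoping P_k = P_k² + P_{k+1}, with one factor P_k moved across the inner product, exhibits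
⟨QPx, x⟩ as a sum of values of the form of Q plus a remainder. -/
theorem re_inner_mul_eq_sum {P Q : H →L[𝕜] H} (hP : P.IsPositive) (hP1 : (1 - P).IsPositive)
    (h : Commute Q P) (x : H) (n : ℕ) :
    RCLike.re (inner 𝕜 (Q (P x)) x) =
      ∑ k ∈ Finset.range n, RCLike.re (inner 𝕜 (Q (subSqIter P k x)) (subSqIter P k x)) +
        RCLike.re (inner 𝕜 (Q (subSqIter P n x)) x) := by
  induction n with
  | zero => simp [subSqIter]
  | succ n ih =>
    rw [ih, Finset.sum_range_succ, add_assoc]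
    congr 1
    have hs : (subSqIter P n).IsPositive := (subSqIter_isPositive hP hP1 n).1
    have hc : Q (subSqIter P n (subSqIter P n x)) = subSqIter P n (Q (subSqIter P n x)) :=
      DFunLike.congr_fun (subSqIter_commute h n).eq (subSqIter P n x)
    have h2 : inner 𝕜 (Q (subSqIter P n x)) (subSqIter P n x) =
        inner 𝕜 (Q (subSqIter P n (subSqIter P n x))) x := by
      rw [hc, hs.inner_left_eq_inner_right]
    rw [h2, ← map_add, ← inner_add_left]
    change _ = RCLike.re (inner 𝕜 (_ + Q (subSqIter P n x - subSqIter P n (subSqIter P n x))) x)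
    rw [map_sub, add_sub_cancel]

/-- The telescoped identity with Q = 1 bounds ∑ ‖P_k x‖² by ⟨Px, x⟩, so the terms tend to 0. -/
theorem tendsto_subSqIter {P : H →L[𝕜] H} (hP : P.IsPositive) (hP1 : (1 - P).IsPositive) (x : H) :
    Tendsto (fun n => subSqIter P n x) atTop (𝓝 0) := by
  have hsum : ∀ n, ∑ k ∈ Finset.range n, ‖subSqIter P k x‖ ^ 2 ≤ RCLike.re (inner 𝕜 (P x) x) := by
    intro n
    have h1 := re_inner_mul_eq_sum hP hP1 (Commute.one_left P) x n
    simp only [one_apply_eq_self, inner_self_eq_norm_sq] at h1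
    have h2 := (subSqIter_isPositive hP hP1 n).1.re_inner_nonneg_left x
    linarith
  have h3 : Summable fun k => ‖subSqIter P k x‖ ^ 2 :=
    summable_of_sum_range_le (fun _ => sq_nonneg _) hsum
  have h4 := (h3.tendsto_atTop_zero).sqrt
  simp only [Real.sqrt_sq (norm_nonneg _), Real.sqrt_zero] at h4
  exact tendsto_zero_iff_norm_tendsto_zero.2 h4

omit [CompleteSpace H] in
theorem isPositive_smul_of_nonneg {P : H →L[𝕜] H} (hP : P.IsPositive) {r : ℝ} (hr : 0 ≤ r) :
    ((r : 𝕜) • P).IsPositive := by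
  refine ⟨fun x y => ?_, fun x => ?_⟩
  · change inner 𝕜 ((r : 𝕜) • P x) y = inner 𝕜 x ((r : 𝕜) • P y)
    rw [inner_smul_left, inner_smul_right, RCLike.conj_ofReal, hP.inner_left_eq_inner_right]
  · change 0 ≤ RCLike.re (inner 𝕜 ((r : 𝕜) • P x) x)
    rw [inner_smul_left, RCLike.conj_ofReal, RCLike.re_ofReal_mul]
    exact mul_nonneg hr (hP.re_inner_nonneg_left x)

theorem isPositive_smul_one_sub {P : H →L[𝕜] H} (hP : IsSelfAdjoint P) {r : ℝ} (hr : ‖P‖ ≤ r) :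
    ((r : 𝕜) • 1 - P).IsPositive := by
  have hsym := ContinuousLinearMap.isSelfAdjoint_iff_isSymmetric.1 hP
  refine ⟨fun x y => ?_, fun x => ?_⟩
  · change inner 𝕜 ((r : 𝕜) • x - P x) y = inner 𝕜 x ((r : 𝕜) • y - P y)
    rw [inner_sub_left, inner_sub_right, inner_smul_left, inner_smul_right, RCLike.conj_ofReal]
    congr 1
    exact hsym x y
  · change 0 ≤ RCLike.re (inner 𝕜 ((r : 𝕜) • x - P x) x)
    rw [inner_sub_left, inner_smul_left, RCLike.conj_ofReal, map_sub, RCLike.re_ofReal_mul,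
      inner_self_eq_norm_sq]
    have h1 : RCLike.re (inner 𝕜 (P x) x) ≤ ‖P x‖ * ‖x‖ := re_inner_le_norm _ _
    have h2 := P.le_of_opNorm_le hr x
    nlinarith [norm_nonneg x]

/-- The product of commuting positive operators is positive. -/
theorem isPositive_mul_of_commute {P Q : H →L[𝕜] H} (hP : P.IsPositive) (hQ : Q.IsPositive)
    (h : Commute Q P) : (Q * P).IsPositive := by
  have key : ∀ R : H →L[𝕜] H, R.IsPositive → (1 - R).IsPositive → Commute Q R → ∀ x,
      0 ≤ RCLike.re (inner 𝕜 (Q (R x)) x) := by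
    intro R hR hR1 hc x
    have h1 : Tendsto (fun n => RCLike.re (inner 𝕜 (Q (subSqIter R n x)) x)) atTop (𝓝 0) := by
      have h2 : Continuous fun y : H => RCLike.re (inner 𝕜 (Q y) x) := by fun_prop
      have h3 := (h2.tendsto 0).comp (tendsto_subSqIter hR hR1 x)
      rwa [map_zero, inner_zero_left, map_zero] at h3
    refine le_of_tendsto' h1 fun n => ?_
    rw [re_inner_mul_eq_sum hR hR1 hc x n]
    have : 0 ≤ ∑ k ∈ Finset.range n,
        RCLike.re (inner 𝕜 (Q (subSqIter R k x)) (subSqIter R k x)) :=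
      Finset.sum_nonneg fun k _ => hQ.re_inner_nonneg_left _
    linarith
  -- Rescaling brings P below 1, as the iteration requires; the added 1 covers P = 0.
  set c : ℝ := (‖P‖ + 1)⁻¹ with hc
  have hpos : 0 < ‖P‖ + 1 := by positivity
  have hc0 : 0 < c := inv_pos.2 hpos
  have h1 : (1 - (c : 𝕜) • P).IsPositive := by
    have := isPositive_smul_of_nonneg (isPositive_smul_one_sub hP.isSelfAdjoint
      (r := ‖P‖ + 1) (by linarith)) hc0.le
    rwa [smul_sub, smul_smul, ← RCLike.ofReal_mul, hc, inv_mul_cancel₀ hpos.ne',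
      RCLike.ofReal_one, one_smul] at this
  refine ⟨?_, fun x => ?_⟩
  · refine ContinuousLinearMap.isSelfAdjoint_iff_isSymmetric.1 ?_
    exact (IsSelfAdjoint.commute_iff hQ.isSelfAdjoint hP.isSelfAdjoint).1 h
  · have h2 := key _ (isPositive_smul_of_nonneg hP hc0.le) h1 (h.smul_right _) x
    change 0 ≤ RCLike.re (inner 𝕜 (Q ((c : 𝕜) • P x)) x) at h2
    rw [map_smul, inner_smul_left, RCLike.conj_ofReal, RCLike.re_ofReal_mul] at h2
    exact nonneg_of_mul_nonneg_right h2 hc0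

end PositiveProduct

/-! ### States, multiplicative states and Krein–Milman -/

section States

variable {𝕜 H : Type*} [RCLike 𝕜] [NormedAddCommGroup H] [InnerProductSpace 𝕜 H]
  [CompleteSpace H]

/-- States of an algebra of operators. -/
structure IsState (𝒜 : StarSubalgebra 𝕜 (H →L[𝕜] H)) (φ : 𝒜 → 𝕜) : Prop where
  map_add : ∀ a b, φ (a + b) = φ a + φ b
  map_smul : ∀ (c : 𝕜) a, φ (c • a) = c * φ a
  map_star : ∀ a, φ (star a) = star (φ a)
  map_one : φ 1 = 1
  nonneg : ∀ a : 𝒜, (a : H →L[𝕜] H).IsPositive → 0 ≤ RCLike.re (φ a)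

/-- The set of states. -/
def stateSpace (𝒜 : StarSubalgebra 𝕜 (H →L[𝕜] H)) : Set (𝒜 → 𝕜) := {φ | IsState 𝒜 φ}

/-- The set of multiplicative states. -/
def charSpace (𝒜 : StarSubalgebra 𝕜 (H →L[𝕜] H)) : Set (𝒜 → 𝕜) :=
  {φ | IsState 𝒜 φ ∧ ∀ a b, φ (a * b) = φ a * φ b}

variable {𝒜 : StarSubalgebra 𝕜 (H →L[𝕜] H)}

namespace IsState

variable {φ : 𝒜 → 𝕜} (h : IsState 𝒜 φ)
include h

theorem map_neg (a : 𝒜) : φ (-a) = -φ a := by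
  simpa using h.map_smul (-1) a

theorem map_sub (a b : 𝒜) : φ (a - b) = φ a - φ b := by
  rw [sub_eq_add_neg, h.map_add, h.map_neg, sub_eq_add_neg]

/-- Positivity at (a - φ(a))*(a - φ(a)) gives |φ(a)|² ≤ φ(a*a), and positivity at ‖a‖² - a*a gives
φ(a*a) ≤ ‖a‖². -/
theorem norm_apply_le (a : 𝒜) : ‖φ a‖ ≤ ‖a‖ := by
  have h1 : 0 ≤ RCLike.re (φ (star (a - φ a • 1) * (a - φ a • 1))) :=
    h.nonneg _ (ContinuousLinearMap.isPositive_adjoint_comp_self _)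
  have e1 : star (a - φ a • 1) * (a - φ a • 1) =
      star a * a - φ a • star a - star (φ a) • a + (star (φ a) * φ a) • (1 : 𝒜) := by
    rw [star_sub, star_smul, star_one, sub_mul, mul_sub, mul_sub, smul_mul_assoc, smul_mul_assoc,
      one_mul, one_mul, mul_smul_comm, mul_one, smul_smul]
    abel
  rw [e1, h.map_add, h.map_sub, h.map_sub, h.map_smul, h.map_smul, h.map_smul, h.map_star,
    h.map_one] at h1
  have e2 : φ (star a * a) - φ a * star (φ a) - star (φ a) * φ a + star (φ a) * φ a * 1 =
      φ (star a * a) - ((‖φ a‖ ^ 2 : ℝ) : 𝕜) := by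
    rw [RCLike.ofReal_pow, ← RCLike.mul_conj]
    change _ = φ (star a * a) - φ a * star (φ a)
    ring
  rw [e2, _root_.map_sub, RCLike.ofReal_re] at h1
  have h2 : 0 ≤ RCLike.re (φ (((‖a‖ ^ 2 : ℝ) : 𝕜) • 1 - star a * a)) := by
    refine h.nonneg _ (isPositive_smul_one_sub (IsSelfAdjoint.star_mul_self (a : H →L[𝕜] H)) ?_)
    rw [CStarRing.norm_star_mul_self, sq]
    rfl
  rw [h.map_sub, h.map_smul, h.map_one, mul_one, _root_.map_sub, RCLike.ofReal_re] at h2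
  exact abs_le_of_sq_le_sq' (by linarith) (norm_nonneg _) |>.2

end IsState

theorem isClosed_stateSpace : IsClosed (stateSpace 𝒜) := by
  have : stateSpace 𝒜 = {φ | ∀ a b, φ (a + b) = φ a + φ b} ∩
      {φ | ∀ (c : 𝕜) a, φ (c • a) = c * φ a} ∩ {φ | ∀ a, φ (star a) = star (φ a)} ∩
      {φ | φ 1 = 1} ∩ {φ | ∀ a : 𝒜, (a : H →L[𝕜] H).IsPositive → 0 ≤ RCLike.re (φ a)} := by
    ext φ
    exact ⟨fun h => ⟨⟨⟨⟨h.1, h.2⟩, h.3⟩, h.4⟩, h.5⟩,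
      fun h => ⟨h.1.1.1.1, h.1.1.1.2, h.1.1.2, h.1.2, h.2⟩⟩
  rw [this]
  simp only [Set.ofPred_forall]
  refine ((((?_ : IsClosed _).inter ?_).inter ?_).inter ?_).inter ?_
  · exact isClosed_iInter fun a => isClosed_iInter fun b => isClosed_eq (by fun_prop) (by fun_prop)
  · exact isClosed_iInter fun a => isClosed_iInter fun b => isClosed_eq (by fun_prop) (by fun_prop)
  · exact isClosed_iInter fun a => isClosed_eq (by fun_prop) (by fun_prop)
  · exact isClosed_eq (by fun_prop) (by fun_prop)
  · exact isClosed_iInter fun a => isClosed_iInter fun _ =>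
      isClosed_le (by fun_prop) (RCLike.continuous_re.comp (continuous_apply a))

/-- Tychonoff: states lie in the product of the closed balls of radius ‖a‖. -/
theorem isCompact_stateSpace : IsCompact (stateSpace 𝒜) := by
  refine IsCompact.of_isClosed_subset
    (isCompact_univ_pi fun a : 𝒜 => isCompact_closedBall (0 : 𝕜) ‖a‖) isClosed_stateSpace ?_
  intro φ hφ a _
  simpa using IsState.norm_apply_le hφ a

theorem isClosed_charSpace : IsClosed (charSpace 𝒜) := by
  have : charSpace 𝒜 = stateSpace 𝒜 ∩ {φ | ∀ a b, φ (a * b) = φ a * φ b} := rfl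
  rw [this]
  simp only [Set.ofPred_forall]
  exact isClosed_stateSpace.inter (isClosed_iInter fun a => isClosed_iInter fun b =>
    isClosed_eq (by fun_prop) (by fun_prop))

theorem isCompact_charSpace : IsCompact (charSpace 𝒜) :=
  isCompact_stateSpace.of_isClosed_subset isClosed_charSpace fun _ h => h.1

theorem convex_stateSpace : Convex ℝ (stateSpace 𝒜) := by
  intro φ hφ ψ hψ r s hr hs hrs
  have e : ∀ a, (r • φ + s • ψ) a = (r : 𝕜) * φ a + (s : 𝕜) * ψ a := fun a => by
    simp [RCLike.real_smul_eq_coe_mul]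
  refine ⟨fun a b => ?_, fun c a => ?_, fun a => ?_, ?_, fun a ha => ?_⟩
  · rw [e, e, e, hφ.map_add, hψ.map_add]; ring
  · rw [e, e, hφ.map_smul, hψ.map_smul]; ring
  · rw [e, e, hφ.map_star, hψ.map_star]; simp
  · rw [e, hφ.map_one, hψ.map_one, mul_one, mul_one]; exact_mod_cast hrs
  · rw [e, map_add, RCLike.re_ofReal_mul, RCLike.re_ofReal_mul]
    exact add_nonneg (mul_nonneg hr (hφ.nonneg a ha)) (mul_nonneg hs (hψ.nonneg a ha))

theorem vectorState_mem {x : H} (hx : ‖x‖ = 1) :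
    (fun a : 𝒜 => inner 𝕜 x ((a : H →L[𝕜] H) x)) ∈ stateSpace 𝒜 := by
  refine ⟨fun a b => ?_, fun c a => ?_, fun a => ?_, ?_, fun a ha => ?_⟩
  · simp [inner_add_right]
  · simp [inner_smul_right]
  · change inner 𝕜 x (ContinuousLinearMap.adjoint (a : H →L[𝕜] H) x) = (starRingEnd 𝕜) _
    rw [ContinuousLinearMap.adjoint_inner_right, inner_conj_symm]
  · change inner 𝕜 x x = 1
    rw [inner_self_eq_norm_sq_to_K, hx]; simp
  · exact ha.re_inner_nonneg_right x

variable (hcomm : ∀ a b : 𝒜, a * b = b * a)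
include hcomm

/-- Positivity survives because h and a commute, so that ha is positive whenever a is. These
compressions serve to decompose a state. -/
theorem IsState.compress {φ : 𝒜 → 𝕜} (hφ : IsState 𝒜 φ) {h : 𝒜} (hh : (h : H →L[𝕜] H).IsPositive)
    {r : ℝ} (hr : 0 < r) (hφh : φ h = r) : IsState 𝒜 fun a => (r : 𝕜)⁻¹ * φ (h * a) := by
  have hne : (r : 𝕜) ≠ 0 := by exact_mod_cast hr.ne'
  refine ⟨fun a b => ?_, fun c a => ?_, fun a => ?_, ?_, fun a ha => ?_⟩
  · rw [mul_add, hφ.map_add, mul_add]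
  · rw [mul_smul_comm, hφ.map_smul]; ring
  · have : h * star a = star (h * a) := by
      rw [star_mul, hcomm h (star a)]
      congr 1
      exact Subtype.ext hh.isSelfAdjoint.star_eq.symm
    rw [this, hφ.map_star, star_mul']
    congr 1
    simp
  · rw [mul_one, hφh, inv_mul_cancel₀ hne]
  · rw [← RCLike.ofReal_inv, RCLike.re_ofReal_mul]
    refine mul_nonneg (inv_nonneg.2 hr.le) (hφ.nonneg _ (isPositive_mul_of_commute ha hh ?_))
    exact congrArg Subtype.val (hcomm h a)

/-- φ is the convex combination, with weights φ(h) and 1 - φ(h), of its compressions by h and by 1 -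
h. Extremality forces the first compression to be φ itself. -/
theorem IsState.map_mul_of_isPositive {φ : 𝒜 → 𝕜} (hφ : φ ∈ (stateSpace 𝒜).extremePoints ℝ)
    {h : 𝒜} (hh : (h : H →L[𝕜] H).IsPositive) (hh1 : ((1 - h : 𝒜) : H →L[𝕜] H).IsPositive)
    {r : ℝ} (hr : 0 < r) (hr1 : r < 1) (hφh : φ h = r) (a : 𝒜) : φ (h * a) = φ h * φ a := by
  have hs : IsState 𝒜 φ := hφ.1
  have hne : (r : 𝕜) ≠ 0 := by exact_mod_cast hr.ne'
  have hne1 : ((1 - r : ℝ) : 𝕜) ≠ 0 := by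
    have : (1 - r : ℝ) ≠ 0 := by linarith
    exact_mod_cast this
  have h1 := hs.compress hcomm hh hr hφh
  have h2 := hs.compress hcomm hh1 (r := 1 - r) (by linarith)
    (by rw [hs.map_sub, hs.map_one, hφh]; simp)
  have h3 := hφ.2 h1 h2 ⟨r, 1 - r, hr, by linarith, by ring, by
    funext b
    simp only [Pi.add_apply, Pi.smul_apply, RCLike.real_smul_eq_coe_mul]
    rw [mul_inv_cancel_left₀ hne, mul_inv_cancel_left₀ hne1, ← hs.map_add, ← add_mul,
      add_sub_cancel, one_mul]⟩
  have h4 : (r : 𝕜)⁻¹ * φ (h * a) = φ a := congrFun h3 a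
  rw [hφh, ← h4, mul_inv_cancel_left₀ hne]

theorem IsState.map_mul_of_isSelfAdjoint {φ : 𝒜 → 𝕜} (hφ : φ ∈ (stateSpace 𝒜).extremePoints ℝ)
    {b : 𝒜} (hb : IsSelfAdjoint (b : H →L[𝕜] H)) (a : 𝒜) : φ (b * a) = φ b * φ a := by
  have hs : IsState 𝒜 φ := hφ.1
  have hpos : 0 < 4 * (‖b‖ + 1) := by positivity
  -- With this c, ‖cb‖ ≤ 1/4, so h = 1/2 + cb satisfies 0 ≤ h ≤ 1 and φ(h) lies strictly between 0
  -- and 1. Multiplicativity at h then gives it at b by linearity.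
  set c : ℝ := (4 * (‖b‖ + 1))⁻¹ with hc
  have hc0 : 0 < c := inv_pos.2 hpos
  have hcb : c * ‖b‖ ≤ 1 / 4 := by
    rw [hc, inv_mul_le_iff₀ hpos]; linarith
  have hsa : IsSelfAdjoint (((c : 𝕜) • b : 𝒜) : H →L[𝕜] H) := by
    change star ((c : 𝕜) • (b : H →L[𝕜] H)) = (c : 𝕜) • (b : H →L[𝕜] H)
    rw [star_smul, hb.star_eq]
    simp
  have hnorm : ‖(((c : 𝕜) • b : 𝒜) : H →L[𝕜] H)‖ ≤ 1 / 2 := by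
    change ‖(c : 𝕜) • (b : H →L[𝕜] H)‖ ≤ 1 / 2
    rw [norm_smul, RCLike.norm_ofReal, abs_of_pos hc0]
    change c * ‖b‖ ≤ 1 / 2
    linarith
  set h : 𝒜 := ((1 / 2 : ℝ) : 𝕜) • 1 + (c : 𝕜) • b with hh
  have hh0 : (h : H →L[𝕜] H).IsPositive := by
    have := isPositive_smul_one_sub (𝕜 := 𝕜) hsa.neg (r := 1 / 2) (by rwa [norm_neg])
    rwa [sub_neg_eq_add] at this
  have hh1 : ((1 - h : 𝒜) : H →L[𝕜] H).IsPositive := by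
    have := isPositive_smul_one_sub (𝕜 := 𝕜) hsa hnorm
    have e : 1 - h = ((1 / 2 : ℝ) : 𝕜) • 1 - (c : 𝕜) • b := by
      have : ((1 / 2 : ℝ) : 𝕜) • (1 : 𝒜) + ((1 / 2 : ℝ) : 𝕜) • 1 = 1 := by
        rw [← add_smul, ← RCLike.ofReal_add]; norm_num
      rw [hh]; nth_rw 1 [← this]; abel
    rw [e]
    exact this
  have hreal : φ b = (RCLike.re (φ b) : 𝕜) := by
    have h1 : star (φ b) = φ b := by
      rw [← hs.map_star]; congr 1; exact Subtype.ext hb.star_eq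
    exact (RCLike.conj_eq_iff_re.1 h1).symm
  have hφh : φ h = ((1 / 2 + c * RCLike.re (φ b) : ℝ) : 𝕜) := by
    rw [hh, hs.map_add, hs.map_smul, hs.map_smul, hs.map_one, mul_one, RCLike.ofReal_add,
      RCLike.ofReal_mul, ← hreal]
  have hbd : |RCLike.re (φ b)| ≤ ‖b‖ := (RCLike.abs_re_le_norm _).trans (hs.norm_apply_le b)
  have hbd' : |c * RCLike.re (φ b)| ≤ 1 / 4 := by
    rw [abs_mul, abs_of_pos hc0]
    exact (mul_le_mul_of_nonneg_left hbd hc0.le).trans hcb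
  rw [abs_le] at hbd'
  have h5 := IsState.map_mul_of_isPositive hcomm hφ hh0 hh1 (by linarith) (by linarith) hφh a
  rw [hh, add_mul, smul_mul_assoc, smul_mul_assoc, one_mul, hs.map_add, hs.map_add, hs.map_smul,
    hs.map_smul, hs.map_smul, hs.map_smul, hs.map_one, mul_one, add_mul, mul_assoc] at h5
  have hcne : (c : 𝕜) ≠ 0 := by exact_mod_cast hc0.ne'
  exact mul_left_cancel₀ hcne (add_left_cancel h5)

variable (hreal : (RCLike.I : 𝕜) = 0 → ∀ a : 𝒜, IsSelfAdjoint (a : H →L[𝕜] H))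
include hreal

/-- If I = 0 every element is self-adjoint; otherwise b is recovered from the self-adjoint elements
b + b* and I(b - b*). -/
theorem extremePoints_stateSpace_subset : (stateSpace 𝒜).extremePoints ℝ ⊆ charSpace 𝒜 := by
  intro φ hφ
  have hs : IsState 𝒜 φ := hφ.1
  refine ⟨hs, fun b a => ?_⟩
  by_cases hI : (RCLike.I : 𝕜) = 0
  · exact IsState.map_mul_of_isSelfAdjoint hcomm hφ (hreal hI b) a
  · have h1 := IsState.map_mul_of_isSelfAdjoint hcomm hφ (b := b + star b)
      (IsSelfAdjoint.add_star_self (b : H →L[𝕜] H)) a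
    have h2 := IsState.map_mul_of_isSelfAdjoint hcomm hφ
      (b := (RCLike.I : 𝕜) • (b - star b)) (by
        change star ((RCLike.I : 𝕜) • ((b : H →L[𝕜] H) - star (b : H →L[𝕜] H))) =
          (RCLike.I : 𝕜) • ((b : H →L[𝕜] H) - star (b : H →L[𝕜] H))
        rw [star_smul, star_sub, star_star, RCLike.star_def, RCLike.conj_I, neg_smul, ← smul_neg,
          neg_sub]) a
    rw [smul_mul_assoc, hs.map_smul, hs.map_smul, mul_assoc] at h2
    have h3 := mul_left_cancel₀ hI h2
    rw [sub_mul, hs.map_sub, hs.map_sub, sub_mul] at h3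
    rw [add_mul, hs.map_add, hs.map_add, add_mul] at h1
    have h4 : (2 : 𝕜) * φ (b * a) = 2 * (φ b * φ a) := by linear_combination h1 + h3
    exact mul_left_cancel₀ two_ne_zero h4

/-- The inequality φ(c² - a*a) ≥ 0 holds at multiplicative states, hence at extreme states, hence at
all states by Krein–Milman. At vector states it says ‖ay‖ ≤ c for unit y. -/
theorem norm_le_of_forall_char {a : 𝒜} {c : ℝ} (hc : 0 ≤ c) (h : ∀ χ ∈ charSpace 𝒜, ‖χ a‖ ≤ c) :
    ‖a‖ ≤ c := by
  set b : 𝒜 := ((c ^ 2 : ℝ) : 𝕜) • 1 - star a * a with hb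
  have hφb : ∀ φ, IsState 𝒜 φ → RCLike.re (φ b) = c ^ 2 - RCLike.re (φ (star a * a)) := by
    intro φ hφ
    rw [hb, hφ.map_sub, hφ.map_smul, hφ.map_one, mul_one, map_sub, RCLike.ofReal_re]
  have hK : stateSpace 𝒜 ⊆ {φ | 0 ≤ RCLike.re (φ b)} := by
    rw [← closure_convexHull_extremePoints isCompact_stateSpace convex_stateSpace]
    refine closure_minimal (convexHull_min ?_ ?_) ?_
    · intro χ hχ
      have hχ' := extremePoints_stateSpace_subset hcomm hreal hχ
      change 0 ≤ RCLike.re (χ b)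
      rw [hφb _ hχ'.1, hχ'.2, hχ'.1.map_star, RCLike.star_def, RCLike.conj_mul,
        ← RCLike.ofReal_pow, RCLike.ofReal_re]
      have := h χ hχ'
      have := norm_nonneg (χ a)
      nlinarith
    · intro φ hφ ψ hψ r s hr hs _
      change 0 ≤ RCLike.re (r • φ b + s • ψ b)
      rw [map_add, RCLike.smul_re, RCLike.smul_re]
      exact add_nonneg (mul_nonneg hr hφ) (mul_nonneg hs hψ)
    · exact isClosed_le continuous_const (RCLike.continuous_re.comp (continuous_apply b))
  refine ContinuousLinearMap.opNorm_le_bound' _ hc fun x hx => ?_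
  have hne : (‖x‖ : 𝕜) ≠ 0 := by exact_mod_cast hx
  set y : H := (‖x‖ : 𝕜)⁻¹ • x with hy
  have hy1 : ‖y‖ = 1 := by
    rw [hy, norm_smul, norm_inv, RCLike.norm_ofReal, abs_norm, inv_mul_cancel₀ hx]
  have hxy : x = (‖x‖ : 𝕜) • y := by rw [hy, smul_inv_smul₀ hne]
  have h1 := hK (vectorState_mem (𝒜 := 𝒜) hy1)
  change 0 ≤ RCLike.re _ at h1
  rw [hφb _ (vectorState_mem hy1)] at h1
  have h2 : inner 𝕜 y (((star a * a : 𝒜) : H →L[𝕜] H) y) =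
      inner 𝕜 ((a : H →L[𝕜] H) y) ((a : H →L[𝕜] H) y) :=
    ContinuousLinearMap.adjoint_inner_right (a : H →L[𝕜] H) y ((a : H →L[𝕜] H) y)
  rw [h2, inner_self_eq_norm_sq] at h1
  have h3 : ‖(a : H →L[𝕜] H) y‖ ≤ c := abs_le_of_sq_le_sq' (by linarith) hc |>.2
  rw [hxy, map_smul, norm_smul, norm_smul, hy1, mul_one, mul_comm]
  exact mul_le_mul_of_nonneg_right h3 (norm_nonneg _)

end States

/-! ### Gelfand representation and the continuous calculus -/

section ContinuousCalculus

variable {𝕜 H : Type*} [RCLike 𝕜] [NormedAddCommGroup H] [InnerProductSpace 𝕜 H]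
  [CompleteSpace H]

/-- The Gelfand transform of a commutative algebra of operators. -/
def gelfand (𝒜 : StarSubalgebra 𝕜 (H →L[𝕜] H)) : 𝒜 →⋆ₐ[𝕜] C(charSpace 𝒜, 𝕜) where
  toFun a := ⟨fun χ => χ.1 a, (continuous_apply a).comp continuous_subtype_val⟩
  map_one' := ContinuousMap.ext fun χ => χ.2.1.map_one
  map_mul' a b := ContinuousMap.ext fun χ => χ.2.2 a b
  map_zero' := ContinuousMap.ext fun χ => by
    have := χ.2.1.map_smul 0 0
    rwa [zero_smul, zero_mul] at this
  map_add' a b := ContinuousMap.ext fun χ => χ.2.1.map_add a b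
  commutes' c := ContinuousMap.ext fun χ => by
    have := χ.2.1.map_smul c 1
    rw [χ.2.1.map_one, mul_one] at this
    rw [Algebra.algebraMap_eq_smul_one]
    exact this
  map_star' a := ContinuousMap.ext fun χ => χ.2.1.map_star a

variable {𝒜 : StarSubalgebra 𝕜 (H →L[𝕜] H)}

instance : CompactSpace (charSpace 𝒜) := isCompact_iff_compactSpace.1 isCompact_charSpace

section

variable (hcomm : ∀ a b : 𝒜, a * b = b * a)
  (hreal : (RCLike.I : 𝕜) = 0 → ∀ a : 𝒜, IsSelfAdjoint (a : H →L[𝕜] H))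
include hcomm hreal

theorem norm_gelfand (a : 𝒜) : ‖gelfand 𝒜 a‖ = ‖a‖ := by
  refine le_antisymm ?_ ?_
  · exact (ContinuousMap.norm_le _ (norm_nonneg _)).2 fun χ => χ.2.1.norm_apply_le a
  · exact norm_le_of_forall_char hcomm hreal (norm_nonneg _)
      fun χ hχ => (gelfand 𝒜 a).norm_coe_le_norm ⟨χ, hχ⟩

/-- An isometry on a complete space has closed range, and the range is dense by Stone–Weierstrass.
-/
theorem gelfand_bijective (hclosed : IsClosed (𝒜 : Set (H →L[𝕜] H))) :
    Function.Bijective (gelfand 𝒜) := by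
  have hiso : Isometry (gelfand 𝒜) :=
    AddMonoidHomClass.isometry_of_norm _ (norm_gelfand hcomm hreal)
  refine ⟨hiso.injective, fun f => ?_⟩
  have : CompleteSpace 𝒜 := hclosed.completeSpace_coe
  have hcl : IsClosed (Set.range (gelfand 𝒜)) := hiso.isClosedEmbedding.isClosed_range
  have hsep : (gelfand 𝒜).range.SeparatesPoints := by
    intro χ ψ hne
    obtain ⟨a, ha⟩ : ∃ a, χ.1 a ≠ ψ.1 a := by
      by_contra! h
      exact hne (Subtype.ext (funext h))
    exact ⟨gelfand 𝒜 a, ⟨gelfand 𝒜 a, ⟨a, rfl⟩, rfl⟩, ha⟩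
  have hdense := ContinuousMap.starSubalgebra_topologicalClosure_eq_top_of_separatesPoints _ hsep
  have hf : f ∈ (gelfand 𝒜).range.topologicalClosure := hdense ▸ trivial
  have hf' : f ∈ closure (Set.range (gelfand 𝒜)) := hf
  rwa [hcl.closure_eq] at hf'

end

/-- Characters are continuous star homomorphisms, so their values on the generators determine them.
For finitely many generators this embeds the character space into a finite power of 𝕜, which makes
it metrizable. -/
theorem charSpace_injective_of_adjoin {ι : Type*} {N : ι → 𝒜}
    (hgen : (𝒜 : Set (H →L[𝕜] H)) ⊆
      closure (StarAlgebra.adjoin 𝕜 (Set.range fun i => (N i : H →L[𝕜] H)) : Set (H →L[𝕜] H)))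
    (hle : StarAlgebra.adjoin 𝕜 (Set.range fun i => (N i : H →L[𝕜] H)) ≤ 𝒜) :
    Function.Injective fun (χ : charSpace 𝒜) (i : ι) => χ.1 (N i) := by
  intro χ ψ h
  have hcont : ∀ θ : charSpace 𝒜, Continuous θ.1 := fun θ => by
    refine LipschitzWith.continuous (K := 1) (LipschitzWith.of_dist_le_mul fun a b => ?_)
    rw [dist_eq_norm, dist_eq_norm, ← θ.2.1.map_sub, NNReal.coe_one, one_mul]
    exact θ.2.1.norm_apply_le _
  have hadj : ∀ a (ha : a ∈ StarAlgebra.adjoin 𝕜 (Set.range fun i => (N i : H →L[𝕜] H))),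
      gelfand 𝒜 ⟨a, hle ha⟩ χ = gelfand 𝒜 ⟨a, hle ha⟩ ψ := by
    intro a ha
    induction ha using StarAlgebra.adjoin_induction with
    | mem x hx =>
      obtain ⟨i, rfl⟩ := hx
      exact congrFun h i
    | algebraMap r =>
      have : ∀ h', (⟨algebraMap 𝕜 (H →L[𝕜] H) r, h'⟩ : 𝒜) = algebraMap 𝕜 𝒜 r := fun _ => rfl
      rw [this, AlgHomClass.commutes]
      rfl
    | add x y hx hy hx' hy' =>
      have : ∀ h', (⟨x + y, h'⟩ : 𝒜) = ⟨x, hle hx⟩ + ⟨y, hle hy⟩ := fun _ => rfl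
      rw [this, map_add, ContinuousMap.add_apply, ContinuousMap.add_apply, hx', hy']
    | mul x y hx hy hx' hy' =>
      have : ∀ h', (⟨x * y, h'⟩ : 𝒜) = ⟨x, hle hx⟩ * ⟨y, hle hy⟩ := fun _ => rfl
      rw [this, map_mul, ContinuousMap.mul_apply, ContinuousMap.mul_apply, hx', hy']
    | star x hx hx' =>
      have : ∀ h', (⟨star x, h'⟩ : 𝒜) = star ⟨x, hle hx⟩ := fun _ => rfl
      rw [this, map_star, ContinuousMap.star_apply, ContinuousMap.star_apply, hx']
  refine Subtype.ext (funext fun a => ?_)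
  obtain ⟨u, hu, hua⟩ := mem_closure_iff_seq_limit.1 (hgen a.2)
  have hu' : Tendsto (fun n => (⟨u n, hle (hu n)⟩ : 𝒜)) atTop (𝓝 a) := tendsto_subtype_rng.2 hua
  refine tendsto_nhds_unique (((hcont χ).tendsto a).comp hu') ?_
  refine (((hcont ψ).tendsto a).comp hu').congr fun n => ?_
  exact (hadj _ (hu n)).symm

/-- A finite family of commuting normal operators generates a calculus for the continuous functions
on a compact metrizable space. -/
theorem exists_continuousCalculus {ι : Type*} [Finite ι] (N : ι → H →L[𝕜] H)
    (hN : ∀ i j, Commute (N i) (N j)) (hN' : ∀ i j, Commute (N i) (star (N j)))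
    (hreal : (RCLike.I : 𝕜) = 0 → ∀ i, IsSelfAdjoint (N i)) :
    ∃ 𝒜 : StarSubalgebra 𝕜 (H →L[𝕜] H), TopologicalSpace.MetrizableSpace (charSpace 𝒜) ∧
      ∃ (ρ : C(charSpace 𝒜, 𝕜) →⋆ₐ[𝕜] (H →L[𝕜] H)) (n : ι → C(charSpace 𝒜, 𝕜)),
        (∀ f, ‖ρ f‖ ≤ ‖f‖) ∧ ∀ i, ρ (n i) = N i := by
  set s := Set.range N with hs
  set 𝒜 := (StarAlgebra.adjoin 𝕜 s).topologicalClosure with h𝒜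
  have hNmem : ∀ i, N i ∈ 𝒜 := fun i =>
    StarSubalgebra.le_topologicalClosure _ (StarAlgebra.subset_adjoin 𝕜 s ⟨i, rfl⟩)
  have hc : ∀ a ∈ s ∪ star s, ∀ b ∈ s ∪ star s, a * b = b * a := by
    intro a ha b hb
    refine Set.union_star_self_comm ?_ ?_ b hb a ha
    · rintro _ ⟨i, rfl⟩ _ ⟨j, rfl⟩
      exact hN j i
    · rintro _ ⟨i, rfl⟩ _ ⟨j, rfl⟩
      exact hN' j i
  -- The closed star algebra lies in the double centralizer of the generators and their adjoints,
  -- which is commutative because these commute.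
  have hcomm : ∀ a b : 𝒜, a * b = b * a := by
    intro a b
    have h1 := StarSubalgebra.topologicalClosure_adjoin_le_centralizer_centralizer 𝕜 s a.2
    have h2 := StarSubalgebra.topologicalClosure_adjoin_le_centralizer_centralizer 𝕜 s b.2
    rw [← SetLike.mem_coe, StarSubalgebra.coe_centralizer_centralizer] at h1 h2
    exact Subtype.ext (Set.centralizer_centralizer_comm_of_comm hc _ h1 _ h2)
  have hsa : (RCLike.I : 𝕜) = 0 → ∀ a : 𝒜, IsSelfAdjoint (a : H →L[𝕜] H) := by
    intro hI a
    have hadj : ∀ a ∈ StarAlgebra.adjoin 𝕜 s, star a = a := by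
      intro a ha
      induction ha using StarAlgebra.adjoin_induction with
      | mem x hx =>
        obtain ⟨i, rfl⟩ := hx
        exact (hreal hI i).star_eq
      | algebraMap r =>
        have : star r = r := RCLike.conj_eq_iff_im.2 (RCLike.im_eq_zero hI r)
        rw [← algebraMap_star_comm, this]
      | add x y hx hy hx' hy' => rw [star_add, hx', hy']
      | mul x y hx hy hx' hy' =>
        rw [star_mul, hx', hy']
        exact congrArg Subtype.val (hcomm ⟨y, StarSubalgebra.le_topologicalClosure _ hy⟩
          ⟨x, StarSubalgebra.le_topologicalClosure _ hx⟩)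
      | star x hx hx' => rw [hx', hx']
    have hcl : IsClosed {a : H →L[𝕜] H | star a = a} := isClosed_eq continuous_star continuous_id
    exact closure_minimal hadj hcl a.2
  let e := StarAlgEquiv.ofBijective (gelfand 𝒜)
    (gelfand_bijective hcomm hsa (StarSubalgebra.isClosed_topologicalClosure _))
  refine ⟨𝒜, ?_, 𝒜.subtype.comp (e.symm : C(charSpace 𝒜, 𝕜) →⋆ₐ[𝕜] 𝒜),
    fun i => gelfand 𝒜 ⟨N i, hNmem i⟩, fun f => ?_, fun i => ?_⟩
  · have hinj := charSpace_injective_of_adjoin (𝒜 := 𝒜) (N := fun i => ⟨N i, hNmem i⟩)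
      subset_rfl (StarSubalgebra.le_topologicalClosure _)
    have := Fintype.ofFinite ι
    have hcont : Continuous fun (χ : charSpace 𝒜) (i : ι) => χ.1 ⟨N i, hNmem i⟩ :=
      continuous_pi fun i => (continuous_apply _).comp continuous_subtype_val
    exact (hcont.isClosedEmbedding hinj).metrizableSpace
  · change ‖e.symm f‖ ≤ ‖f‖
    rw [← norm_gelfand hcomm hsa]
    exact (congrArg norm (e.apply_symm_apply f)).le
  · exact congrArg Subtype.val (e.symm_apply_apply ⟨N i, hNmem i⟩)

end ContinuousCalculus

open MeasureTheory
open scoped ENNReal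

/-! ### Square-integrable functions -/

section SquareIntegrable

variable {X 𝕜 : Type*} [MeasurableSpace X] [RCLike 𝕜]

theorem eLpNorm_two_sq (f : X → 𝕜) (μ : Measure X) :
    eLpNorm f 2 μ ^ 2 = ∫⁻ a, ‖f a‖ₑ ^ 2 ∂μ := by
  have := eLpNorm_nnreal_pow_eq_lintegral (f := f) (μ := μ) (p := 2) two_ne_zero
  simp only [NNReal.coe_ofNat, ENNReal.rpow_ofNat] at this
  exact this

theorem memLp_two_iff {f : X → 𝕜} (hf : Measurable f) {μ : Measure X} :
    MemLp f 2 μ ↔ ∫⁻ a, ‖f a‖ₑ ^ 2 ∂μ < ∞ := by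
  rw [← eLpNorm_two_sq, ENNReal.pow_lt_top_iff]
  simp [MemLp, hf.aestronglyMeasurable]

theorem tendsto_eLpNorm_two_iff {f : ℕ → X → 𝕜} {μ : Measure X} :
    Tendsto (fun n => eLpNorm (f n) 2 μ) atTop (𝓝 0) ↔
      Tendsto (fun n => ∫⁻ a, ‖f n a‖ₑ ^ 2 ∂μ) atTop (𝓝 0) := by
  simp only [← eLpNorm_two_sq]
  constructor
  · intro h
    simpa using ENNReal.Tendsto.pow (n := 2) h
  · intro h
    have h2 := (ENNReal.continuous_rpow_const (y := (1 / 2 : ℝ))).tendsto 0 |>.comp h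
    rw [ENNReal.zero_rpow_of_pos (by norm_num)] at h2
    refine h2.congr fun n => ?_
    change (eLpNorm (f n) 2 μ ^ 2) ^ (1 / 2 : ℝ) = _
    rw [← ENNReal.rpow_natCast, ← ENNReal.rpow_mul]
    norm_num

theorem tendsto_eLpNorm_two_of_bounded {f : ℕ → X → 𝕜} {g : X → 𝕜} {μ : Measure X}
    [IsFiniteMeasure μ] (hf : ∀ n, Measurable (f n)) (hg : Measurable g) {C : ℝ}
    (hC : ∀ n x, ‖f n x‖ ≤ C) (hlim : ∀ x, Tendsto (fun n => f n x) atTop (𝓝 (g x))) :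
    Tendsto (fun n => eLpNorm (f n - g) 2 μ) atTop (𝓝 0) := by
  rw [tendsto_eLpNorm_two_iff]
  have hgC : ∀ x, ‖g x‖ ≤ C := fun x => le_of_tendsto' (hlim x).norm fun n => hC n x
  have h0 : (0 : ℝ≥0∞) = ∫⁻ _ : X, 0 ∂μ := by simp
  rw [h0]
  refine tendsto_lintegral_of_dominated_convergence (fun _ => ENNReal.ofReal (C + C) ^ 2)
    (fun n => ((hf n).sub hg).enorm.pow_const 2) (fun n => ae_of_all _ fun x => ?_) ?_
    (ae_of_all _ fun x => ?_)
  · refine pow_le_pow_left' ?_ 2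
    rw [Pi.sub_apply, ← ofReal_norm]
    exact ENNReal.ofReal_le_ofReal ((norm_sub_le _ _).trans (add_le_add (hC n x) (hgC x)))
  · rw [lintegral_const]
    exact (ENNReal.mul_lt_top (by simp) (measure_lt_top μ _)).ne
  · have h1 : Tendsto (fun n => f n x - g x) atTop (𝓝 0) := by
      simpa using (hlim x).sub_const (g x)
    simpa using ENNReal.Tendsto.pow (n := 2) h1.enorm

end SquareIntegrable

/-! ### Spectral measures of vectors and their isometries -/

section VectorMeasure

variable {X 𝕜 H : Type*} [RCLike 𝕜] [NormedAddCommGroup H] [InnerProductSpace 𝕜 H]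
  [CompleteSpace H] [TopologicalSpace X] [CompactSpace X] [TopologicalSpace.MetrizableSpace X]
  [MeasurableSpace X] [BorelSpace X]

/-- A real continuous function as a `𝕜`-valued one. -/
def toK (𝕜 : Type*) [RCLike 𝕜] {X : Type*} [TopologicalSpace X] (g : C(X, ℝ)) : C(X, 𝕜) :=
  ⟨fun x => (g x : 𝕜), RCLike.continuous_ofReal.comp g.continuous⟩

omit [CompactSpace X] [TopologicalSpace.MetrizableSpace X] [MeasurableSpace X] [BorelSpace X] in
theorem inner_apply_star_mul (ρ : C(X, 𝕜) →⋆ₐ[𝕜] (H →L[𝕜] H)) (f g : C(X, 𝕜)) (x y : H) :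
    inner 𝕜 x (ρ (star f * g) y) = inner 𝕜 (ρ f x) (ρ g y) := by
  rw [map_mul, map_star]
  exact ContinuousLinearMap.adjoint_inner_right (ρ f) x (ρ g y)

omit [CompactSpace X] [TopologicalSpace.MetrizableSpace X] [MeasurableSpace X] [BorelSpace X] in
theorem re_inner_nonneg_of_nonneg (ρ : C(X, 𝕜) →⋆ₐ[𝕜] (H →L[𝕜] H)) (x : H) {g : C(X, ℝ)}
    (hg : ∀ a, 0 ≤ g a) : 0 ≤ RCLike.re (inner 𝕜 x (ρ (toK 𝕜 g) x)) := by
  set s : C(X, ℝ) := ⟨fun a => √(g a), g.continuous.sqrt⟩ with hs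
  have h1 : toK 𝕜 g = star (toK 𝕜 s) * toK 𝕜 s := by
    ext a
    change ((g a : ℝ) : 𝕜) = (starRingEnd 𝕜) ((√(g a) : ℝ) : 𝕜) * ((√(g a) : ℝ) : 𝕜)
    rw [RCLike.conj_ofReal, ← RCLike.ofReal_mul, Real.mul_self_sqrt (hg a)]
  rw [h1, inner_apply_star_mul]
  exact inner_self_nonneg

/-- The positive functional `g ↦ ⟨x, ρ(g) x⟩`. -/
def vecFunctional (ρ : C(X, 𝕜) →⋆ₐ[𝕜] (H →L[𝕜] H)) (x : H) :
    CompactlySupportedContinuousMap X ℝ →ₚ[ℝ] ℝ :=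
  PositiveLinearMap.mk₀
    { toFun := fun g => RCLike.re (inner 𝕜 x (ρ (toK 𝕜 g.toContinuousMap) x))
      map_add' := fun g h => by
        have : toK 𝕜 (g + h).toContinuousMap = toK 𝕜 g.toContinuousMap + toK 𝕜 h.toContinuousMap := by
          ext a
          exact RCLike.ofReal_add _ _
        rw [this, map_add, add_apply, inner_add_right, map_add]
      map_smul' := fun c g => by
        have : toK 𝕜 (c • g).toContinuousMap = (c : 𝕜) • toK 𝕜 g.toContinuousMap := by
          ext a
          exact RCLike.ofReal_mul _ _
        rw [this, map_smul, smul_apply, inner_smul_right, RCLike.re_ofReal_mul]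
        rfl }
    fun g hg => re_inner_nonneg_of_nonneg ρ x hg

/-- The spectral measure of the vector `x`. -/
def vecMeasure (ρ : C(X, 𝕜) →⋆ₐ[𝕜] (H →L[𝕜] H)) (x : H) : Measure X :=
  RealRMK.rieszMeasure (vecFunctional ρ x)

instance (ρ : C(X, 𝕜) →⋆ₐ[𝕜] (H →L[𝕜] H)) (x : H) : IsFiniteMeasure (vecMeasure ρ x) := by
  unfold vecMeasure; infer_instance

variable (ρ : C(X, 𝕜) →⋆ₐ[𝕜] (H →L[𝕜] H))

theorem integral_vecMeasure (x : H) (g : C(X, ℝ)) :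
    ∫ a, g a ∂vecMeasure ρ x = RCLike.re (inner 𝕜 x (ρ (toK 𝕜 g) x)) :=
  RealRMK.integral_rieszMeasure (vecFunctional ρ x)
    ⟨g, HasCompactSupport.of_compactSpace _⟩

/-- Since ρ(f)*ρ(f) = ρ(|f|²), the map f ↦ ρ(f)x is isometric for the norm of L²(μ_x). This is what
allows its extension beyond continuous functions. -/
theorem norm_sq_eq_integral (x : H) (f : C(X, 𝕜)) :
    ‖ρ f x‖ ^ 2 = ∫ a, ‖f a‖ ^ 2 ∂vecMeasure ρ x := by
  have h0 := integral_vecMeasure ρ x ⟨fun a => ‖f a‖ ^ 2, by fun_prop⟩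
  have h1 : toK 𝕜 (⟨fun a => ‖f a‖ ^ 2, by fun_prop⟩ : C(X, ℝ)) = star f * f := by
    ext a
    change ((‖f a‖ ^ 2 : ℝ) : 𝕜) = (starRingEnd 𝕜) (f a) * f a
    rw [RCLike.conj_mul, RCLike.ofReal_pow]
  rw [h1, inner_apply_star_mul, inner_self_eq_norm_sq] at h0
  exact h0.symm

omit [TopologicalSpace.MetrizableSpace X] in
theorem memLp_continuous (μ : Measure X) [IsFiniteMeasure μ] (f : C(X, 𝕜)) : MemLp f 2 μ :=
  f.memLp μ 𝕜

theorem enorm_apply_eq_eLpNorm (x : H) (f : C(X, 𝕜)) :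
    ‖ρ f x‖ₑ = eLpNorm f 2 (vecMeasure ρ x) := by
  have hf := memLp_continuous (vecMeasure ρ x) f
  have h1 := (memLp_two_iff_integrable_sq_norm hf.1).1 hf
  have h2 : ‖ρ f x‖ₑ ^ 2 = eLpNorm f 2 (vecMeasure ρ x) ^ 2 := by
    rw [eLpNorm_two_sq, ← ofReal_norm, ← ENNReal.ofReal_pow (norm_nonneg _),
      norm_sq_eq_integral, ofReal_integral_eq_lintegral_ofReal h1 (ae_of_all _ fun a => by positivity)]
    refine lintegral_congr fun a => ?_
    rw [ENNReal.ofReal_pow (norm_nonneg _), ofReal_norm]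
  exact (ENNReal.pow_right_strictMono two_ne_zero).injective h2

theorem exists_linearIsometry_of_denseRange {E F G : Type*} [AddCommGroup E] [Module 𝕜 E]
    [NormedAddCommGroup F] [NormedSpace 𝕜 F] [NormedAddCommGroup G] [NormedSpace 𝕜 G]
    [CompleteSpace G] (e : E →ₗ[𝕜] F) (f : E →ₗ[𝕜] G) (he : DenseRange e)
    (h : ∀ x, ‖f x‖ = ‖e x‖) : ∃ V : F →ₗᵢ[𝕜] G, ∀ x, V (e x) = f x := by
  have h1 := LinearMap.extendOfNorm_eq (f := f) (e := e) he
    ⟨1, fun x => by rw [one_mul]; exact (h x).le⟩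
  refine ⟨⟨(f.extendOfNorm e).toLinearMap, fun y => ?_⟩, h1⟩
  refine he.induction_on (p := fun y => ‖f.extendOfNorm e y‖ = ‖y‖) y
    (isClosed_eq (f.extendOfNorm e).continuous.norm continuous_norm) fun x => ?_
  rw [h1, h]

/-- The inclusion of the continuous functions into `L²`. -/
def continuousToL2 (μ : Measure X) [IsFiniteMeasure μ] : C(X, 𝕜) →ₗ[𝕜] Lp 𝕜 2 μ where
  toFun f := (memLp_continuous μ f).toLp f
  map_add' f g := MemLp.toLp_add (memLp_continuous μ f) (memLp_continuous μ g)
  map_smul' c f := MemLp.toLp_const_smul c (memLp_continuous μ f)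

theorem denseRange_continuousToL2 (μ : Measure X) [IsFiniteMeasure μ] :
    DenseRange (continuousToL2 (𝕜 := 𝕜) μ) := by
  have h1 : ⇑(continuousToL2 (𝕜 := 𝕜) μ) = ⇑(ContinuousMap.toLp (E := 𝕜) 2 μ 𝕜) := by
    funext f
    exact Lp.ext ((MemLp.coeFn_toLp (memLp_continuous μ f)).trans (ContinuousMap.coeFn_toLp μ f).symm)
  rw [h1]
  exact ContinuousMap.toLp_denseRange 𝕜 μ 𝕜 (by simp)

/-- Evaluation `f ↦ ρ(f) x` of the continuous calculus. -/
def evalMap (x : H) : C(X, 𝕜) →ₗ[𝕜] H where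
  toFun f := ρ f x
  map_add' f g := by rw [map_add]; rfl
  map_smul' c f := by rw [map_smul]; rfl

theorem exists_vecIsometry (x : H) : ∃ V : Lp 𝕜 2 (vecMeasure ρ x) →ₗᵢ[𝕜] H,
    ∀ f, V (continuousToL2 (vecMeasure ρ x) f) = evalMap ρ x f := by
  refine exists_linearIsometry_of_denseRange _ _ (denseRange_continuousToL2 _) fun f => ?_
  change ‖ρ f x‖ = ‖(memLp_continuous (vecMeasure ρ x) f).toLp f‖
  rw [Lp.norm_toLp, ← enorm_apply_eq_eLpNorm, toReal_enorm]

/-- The isometry `L²(μ_x) → H` that extends `f ↦ ρ(f) x`. -/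
def vecIsometry (x : H) : Lp 𝕜 2 (vecMeasure ρ x) →ₗᵢ[𝕜] H := (exists_vecIsometry ρ x).choose

theorem vecIsometry_toLp (x : H) (f : C(X, 𝕜)) :
    vecIsometry ρ x ((memLp_continuous (vecMeasure ρ x) f).toLp f) = ρ f x :=
  (exists_vecIsometry ρ x).choose_spec f

open Classical in
/-- The value at `x` of the operator `Φ(f)`. -/
def val (f : X → 𝕜) (x : H) : H :=
  if h : MemLp f 2 (vecMeasure ρ x) then vecIsometry ρ x (h.toLp f) else 0

variable {ρ}

theorem val_eq {f : X → 𝕜} {x : H} (h : MemLp f 2 (vecMeasure ρ x)) :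
    val ρ f x = vecIsometry ρ x (h.toLp f) := dif_pos h

theorem val_continuous (f : C(X, 𝕜)) (x : H) : val ρ f x = ρ f x := by
  rw [val_eq (memLp_continuous _ f), vecIsometry_toLp]

theorem enorm_val {f : X → 𝕜} {x : H} (h : MemLp f 2 (vecMeasure ρ x)) :
    ‖val ρ f x‖ₑ = eLpNorm f 2 (vecMeasure ρ x) := by
  rw [val_eq h, ← Lp.enorm_toLp h]
  exact congrArg ENNReal.ofNNReal (Subtype.ext ((vecIsometry ρ x).norm_map _))

theorem val_add {f g : X → 𝕜} {x : H} (hf : MemLp f 2 (vecMeasure ρ x))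
    (hg : MemLp g 2 (vecMeasure ρ x)) : val ρ (f + g) x = val ρ f x + val ρ g x := by
  rw [val_eq hf, val_eq hg, val_eq (hf.add hg), MemLp.toLp_add, map_add]

theorem val_sub {f g : X → 𝕜} {x : H} (hf : MemLp f 2 (vecMeasure ρ x))
    (hg : MemLp g 2 (vecMeasure ρ x)) : val ρ (f - g) x = val ρ f x - val ρ g x := by
  rw [val_eq hf, val_eq hg, val_eq (hf.sub hg), MemLp.toLp_sub, map_sub]

theorem val_smul {f : X → 𝕜} {x : H} (c : 𝕜) (hf : MemLp f 2 (vecMeasure ρ x)) :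
    val ρ (c • f) x = c • val ρ f x := by
  rw [val_eq hf, val_eq (hf.const_smul c), MemLp.toLp_const_smul, map_smul]

theorem inner_val {f g : X → 𝕜} {x : H} (hf : MemLp f 2 (vecMeasure ρ x))
    (hg : MemLp g 2 (vecMeasure ρ x)) :
    inner 𝕜 (val ρ f x) (val ρ g x) = ∫ a, inner 𝕜 (f a) (g a) ∂vecMeasure ρ x := by
  rw [val_eq hf, val_eq hg, LinearIsometry.inner_map_map, L2.inner_def]
  refine integral_congr_ae ?_
  filter_upwards [hf.coeFn_toLp, hg.coeFn_toLp] with a h1 h2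
  rw [h1, h2]

theorem tendsto_val {f : ℕ → X → 𝕜} {g : X → 𝕜} {x : H}
    (hf : ∀ n, MemLp (f n) 2 (vecMeasure ρ x)) (hg : MemLp g 2 (vecMeasure ρ x))
    (h : Tendsto (fun n => eLpNorm (f n - g) 2 (vecMeasure ρ x)) atTop (𝓝 0)) :
    Tendsto (fun n => val ρ (f n) x) atTop (𝓝 (val ρ g x)) := by
  rw [tendsto_iff_edist_tendsto_0]
  refine h.congr fun n => ?_
  rw [edist_eq_enorm_sub, ← val_sub (hf n) hg, enorm_val ((hf n).sub hg)]

theorem exists_continuous_tendsto {f : X → 𝕜} {μ : Measure X} [IsFiniteMeasure μ]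
    (hf : MemLp f 2 μ) :
    ∃ g : ℕ → C(X, 𝕜), Tendsto (fun n => eLpNorm (⇑(g n) - f) 2 μ) atTop (𝓝 0) := by
  have h1 : ∀ n : ℕ, ∃ g : C(X, 𝕜), eLpNorm (⇑g - f) 2 μ ≤ (n : ℝ≥0∞)⁻¹ := by
    intro n
    obtain ⟨g, hg, -⟩ := hf.exists_boundedContinuous_eLpNorm_sub_le (by simp)
      (ε := (n : ℝ≥0∞)⁻¹) (by simp)
    refine ⟨g.toContinuousMap, ?_⟩
    rw [eLpNorm_sub_comm]
    exact hg
  choose g hg using h1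
  exact ⟨g, tendsto_of_tendsto_of_tendsto_of_le_of_le tendsto_const_nhds
    ENNReal.tendsto_inv_nat_nhds_zero (fun _ => bot_le) hg⟩

/-- One sequence of continuous functions, approximating f for a measure that dominates several μ_x,
serves all these vectors at once. Identities linking different vectors pass to the limit in this
way. -/
theorem tendsto_apply_of_le {f : X → 𝕜} {μ : Measure X} {g : ℕ → C(X, 𝕜)} {x : H}
    (hg : Tendsto (fun n => eLpNorm (⇑(g n) - f) 2 μ) atTop (𝓝 0)) (hx : vecMeasure ρ x ≤ μ)
    (hf : MemLp f 2 (vecMeasure ρ x)) :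
    Tendsto (fun n => ρ (g n) x) atTop (𝓝 (val ρ f x)) := by
  simp only [← val_continuous]
  refine tendsto_val (fun n => memLp_continuous _ _) hf ?_
  exact tendsto_of_tendsto_of_tendsto_of_le_of_le tendsto_const_nhds hg (fun _ => bot_le)
    fun n => eLpNorm_mono_measure _ hx

end VectorMeasure

/-! ### The calculus of measurable functions on a compact space -/

section UnboundedCalculus

variable {X 𝕜 H : Type*} [RCLike 𝕜] [NormedAddCommGroup H] [InnerProductSpace 𝕜 H]
  [CompleteSpace H] [TopologicalSpace X] [CompactSpace X] [TopologicalSpace.MetrizableSpace X]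
  [MeasurableSpace X] [BorelSpace X] {ρ : C(X, 𝕜) →⋆ₐ[𝕜] (H →L[𝕜] H)}

omit [CompactSpace X] in
theorem measure_ext_of_continuous [CompactSpace X] {μ ν : Measure X} [IsFiniteMeasure μ]
    [IsFiniteMeasure ν] (h : ∀ g : C(X, ℝ), ∫ a, g a ∂μ = ∫ a, g a ∂ν) : μ = ν :=
  ext_of_forall_integral_eq_of_IsFiniteMeasure fun f => h f.toContinuousMap

omit [TopologicalSpace.MetrizableSpace X] in
theorem integrable_continuous (μ : Measure X) [IsFiniteMeasure μ] (g : C(X, ℝ)) :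
    Integrable g μ :=
  memLp_one_iff_integrable.1 (g.memLp μ ℝ)

/-- Each ∫ g dμ_x is a quadratic form in x. The resulting bound μ_{x+y} ≤ 2(μ_x + μ_y) makes the
domain of Φ(f) closed under addition. -/
theorem vecMeasure_parallelogram (x y : H) :
    vecMeasure ρ (x + y) + vecMeasure ρ (x - y) =
      (vecMeasure ρ x + vecMeasure ρ y) + (vecMeasure ρ x + vecMeasure ρ y) := by
  refine measure_ext_of_continuous fun g => ?_
  have hi := fun (μ : Measure X) (_ : IsFiniteMeasure μ) => integrable_continuous μ g
  rw [integral_add_measure (hi _ inferInstance) (hi _ inferInstance),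
    integral_add_measure (hi _ inferInstance) (hi _ inferInstance),
    integral_add_measure (hi _ inferInstance) (hi _ inferInstance)]
  simp only [integral_vecMeasure, map_add, map_sub, inner_add_left, inner_add_right,
    inner_sub_left, inner_sub_right]
  ring

theorem vecMeasure_add_le (x y : H) :
    vecMeasure ρ (x + y) ≤ (2 : ℝ≥0∞) • (vecMeasure ρ x + vecMeasure ρ y) := by
  rw [two_smul, ← vecMeasure_parallelogram]
  exact Measure.le_add_right le_rfl

theorem vecMeasure_smul (c : 𝕜) (x : H) :
    vecMeasure ρ (c • x) = (‖c‖₊ ^ 2) • vecMeasure ρ x := by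
  refine measure_ext_of_continuous fun g => ?_
  rw [integral_smul_nnreal_measure, integral_vecMeasure, integral_vecMeasure, map_smul,
    inner_smul_left, inner_smul_right, ← mul_assoc, RCLike.conj_mul, ← RCLike.ofReal_pow,
    RCLike.re_ofReal_mul]
  rfl

theorem memLp_vecMeasure_add {f : X → 𝕜} (hf : Measurable f) {x y : H}
    (hx : MemLp f 2 (vecMeasure ρ x)) (hy : MemLp f 2 (vecMeasure ρ y)) :
    MemLp f 2 (vecMeasure ρ (x + y)) := by
  refine MemLp.of_measure_le_smul (by simp) (vecMeasure_add_le x y) ?_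
  rw [memLp_two_iff hf, lintegral_add_measure]
  exact ENNReal.add_lt_top.2 ⟨(memLp_two_iff hf).1 hx, (memLp_two_iff hf).1 hy⟩

theorem memLp_vecMeasure_smul {f : X → 𝕜} {x : H} (c : 𝕜)
    (hx : MemLp f 2 (vecMeasure ρ x)) : MemLp f 2 (vecMeasure ρ (c • x)) := by
  rw [vecMeasure_smul]
  exact hx.smul_measure (c := ((‖c‖₊ ^ 2 : NNReal) : ℝ≥0∞)) (by simp)

theorem val_add_right {f : X → 𝕜} (hf : Measurable f) {x y : H}
    (hx : MemLp f 2 (vecMeasure ρ x)) (hy : MemLp f 2 (vecMeasure ρ y)) :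
    val ρ f (x + y) = val ρ f x + val ρ f y := by
  have hxy := memLp_vecMeasure_add hf hx hy
  -- The sum of the three measures dominates each, so a single approximating sequence handles x, y
  -- and x + y.
  have hν : MemLp f 2 (vecMeasure ρ x + vecMeasure ρ y + vecMeasure ρ (x + y)) := by
    rw [memLp_two_iff hf, lintegral_add_measure, lintegral_add_measure]
    exact ENNReal.add_lt_top.2 ⟨ENNReal.add_lt_top.2 ⟨(memLp_two_iff hf).1 hx,
      (memLp_two_iff hf).1 hy⟩, (memLp_two_iff hf).1 hxy⟩
  obtain ⟨g, hg⟩ := exists_continuous_tendsto hν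
  have h1 := tendsto_apply_of_le hg (Measure.le_add_right (Measure.le_add_right le_rfl)) hx
  have h2 := tendsto_apply_of_le hg (Measure.le_add_right (Measure.le_add_left le_rfl)) hy
  have h3 := tendsto_apply_of_le hg (Measure.le_add_left le_rfl) hxy
  simp only [map_add] at h3
  exact tendsto_nhds_unique h3 (h1.add h2)

theorem val_smul_right {f : X → 𝕜} (hf : Measurable f) {x : H} (c : 𝕜)
    (hx : MemLp f 2 (vecMeasure ρ x)) : val ρ f (c • x) = c • val ρ f x := by
  have hcx := memLp_vecMeasure_smul c hx
  have hν : MemLp f 2 (vecMeasure ρ x + vecMeasure ρ (c • x)) := by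
    rw [memLp_two_iff hf, lintegral_add_measure]
    exact ENNReal.add_lt_top.2 ⟨(memLp_two_iff hf).1 hx, (memLp_two_iff hf).1 hcx⟩
  obtain ⟨g, hg⟩ := exists_continuous_tendsto hν
  have h1 := tendsto_apply_of_le hg (Measure.le_add_right le_rfl) hx
  have h3 := tendsto_apply_of_le hg (Measure.le_add_left le_rfl) hcx
  simp only [map_smul] at h3
  exact tendsto_nhds_unique h3 (h1.const_smul c)

variable (ρ) in
/-- The operator `Φ(f)` for a measurable function `f`, with domain `{x | f ∈ L²(μ_x)}`. -/
def borelOp (f : MeasFun X 𝕜) : H →ₗ.[𝕜] H where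
  domain :=
    { carrier := {x | MemLp f.1 2 (vecMeasure ρ x)}
      add_mem' := fun hx hy => memLp_vecMeasure_add f.2 hx hy
      zero_mem' := by
        change MemLp f.1 2 (vecMeasure ρ 0)
        rw [← zero_smul 𝕜 (0 : H), vecMeasure_smul]
        simp
      smul_mem' := fun c _ hx => memLp_vecMeasure_smul c hx }
  toFun :=
    { toFun := fun x => val ρ f.1 x
      map_add' := fun x y => val_add_right f.2 x.2 y.2
      map_smul' := fun c x => val_smul_right f.2 c x.2 }

theorem mem_graph_borelOp {f : MeasFun X 𝕜} {x y : H} :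
    (x, y) ∈ (borelOp ρ f).graph ↔ MemLp f.1 2 (vecMeasure ρ x) ∧ y = val ρ f.1 x := by
  rw [LinearPMap.mem_graph_iff]
  constructor
  · rintro ⟨⟨z, hz⟩, rfl, rfl⟩
    exact ⟨hz, rfl⟩
  · rintro ⟨h, rfl⟩
    exact ⟨⟨x, h⟩, rfl, rfl⟩

omit [TopologicalSpace X] [CompactSpace X] [TopologicalSpace.MetrizableSpace X] [BorelSpace X] in
theorem memLp_of_bounded {f : X → 𝕜} (hf : Measurable f) {C : ℝ} (hC : ∀ a, ‖f a‖ ≤ C)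
    (μ : Measure X) [IsFiniteMeasure μ] : MemLp f 2 μ :=
  MemLp.of_bound hf.aestronglyMeasurable C (ae_of_all _ hC)

/-- Multiplication by h is bounded on L²(μ_x), so ρ(h)ρ(u)x = ρ(hu)x extends from continuous u to g.
-/
theorem apply_val_eq {g : X → 𝕜} {x : H} (hg : MemLp g 2 (vecMeasure ρ x)) (h : C(X, 𝕜)) :
    MemLp (⇑h * g) 2 (vecMeasure ρ x) ∧ ρ h (val ρ g x) = val ρ (⇑h * g) x := by
  have hmul : ∀ u : X → 𝕜, MemLp u 2 (vecMeasure ρ x) → MemLp (⇑h * u) 2 (vecMeasure ρ x) ∧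
      eLpNorm (⇑h * u) 2 (vecMeasure ρ x) ≤
        ENNReal.ofReal ‖h‖ * eLpNorm u 2 (vecMeasure ρ x) := by
    intro u hu
    have hb : ∀ᵐ a ∂vecMeasure ρ x, ‖(⇑h * u) a‖ ≤ ‖h‖ * ‖u a‖ := ae_of_all _ fun a => by
      rw [Pi.mul_apply, norm_mul]
      exact mul_le_mul_of_nonneg_right (h.norm_coe_le_norm a) (norm_nonneg _)
    exact ⟨hu.of_le_mul ((memLp_continuous _ h).1.mul hu.1) hb, eLpNorm_le_mul_eLpNorm_of_ae_le_mul hb 2⟩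
  refine ⟨(hmul g hg).1, ?_⟩
  obtain ⟨u, hu⟩ := exists_continuous_tendsto hg
  have h1 := tendsto_apply_of_le hu le_rfl hg
  have h2 := ((ρ h).continuous.tendsto _).comp h1
  have h3 : Tendsto (fun n => val ρ (⇑(h * u n)) x) atTop (𝓝 (val ρ (⇑h * g) x)) := by
    refine tendsto_val (fun n => memLp_continuous _ _) (hmul g hg).1 ?_
    have h4 := ENNReal.Tendsto.const_mul (a := ENNReal.ofReal ‖h‖) hu (Or.inr (by simp))
    rw [mul_zero] at h4
    refine tendsto_of_tendsto_of_tendsto_of_le_of_le tendsto_const_nhds h4 (fun _ => bot_le)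
      fun n => ?_
    have : ⇑(h * u n) - ⇑h * g = ⇑h * (⇑(u n) - g) := by
      rw [ContinuousMap.coe_mul, mul_sub]
    rw [this]
    exact (hmul _ ((memLp_continuous _ (u n)).sub hg)).2
  refine tendsto_nhds_unique h2 (h3.congr fun n => ?_)
  rw [val_continuous, map_mul]
  rfl

/-- For real continuous f, ⟨Φ(g)x, ρ(f)Φ(g)x⟩ = ∫ f |g|² dμ_x. The density |g|² is the source of the
domain rule for products. -/
theorem vecMeasure_val {g : X → 𝕜} (hgm : Measurable g) {x : H}
    (hg : MemLp g 2 (vecMeasure ρ x)) :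
    vecMeasure ρ (val ρ g x) = (vecMeasure ρ x).withDensity fun a => ‖g a‖ₑ ^ 2 := by
  have hfin : IsFiniteMeasure ((vecMeasure ρ x).withDensity fun a => ‖g a‖ₑ ^ 2) :=
    isFiniteMeasure_withDensity ((memLp_two_iff hgm).1 hg).ne
  refine measure_ext_of_continuous fun f => ?_
  obtain ⟨h1, h2⟩ := apply_val_eq hg (toK 𝕜 f)
  rw [integral_vecMeasure, h2, inner_val hg h1,
    integral_withDensity_eq_integral_toReal_smul (hgm.enorm.pow_const 2)
      (ae_of_all _ fun a => by simp)]
  have h3 : ∀ a, inner 𝕜 (g a) ((⇑(toK 𝕜 f) * g) a) =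
      (((‖g a‖ₑ ^ 2).toReal • f a : ℝ) : 𝕜) := by
    intro a
    have : inner 𝕜 (g a) ((⇑(toK 𝕜 f) * g) a) = ((f a : ℝ) : 𝕜) * g a * (starRingEnd 𝕜) (g a) := rfl
    rw [this, mul_assoc, RCLike.mul_conj, smul_eq_mul, ENNReal.toReal_pow, toReal_enorm, mul_comm]
    simp
  rw [integral_congr_ae (ae_of_all _ h3), integral_ofReal, RCLike.ofReal_re]

theorem memLp_val_iff {f g : X → 𝕜} (hfm : Measurable f) (hgm : Measurable g) {x : H}
    (hg : MemLp g 2 (vecMeasure ρ x)) :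
    MemLp f 2 (vecMeasure ρ (val ρ g x)) ↔ MemLp (f * g) 2 (vecMeasure ρ x) := by
  rw [memLp_two_iff hfm, memLp_two_iff (hfm.mul hgm), vecMeasure_val hgm hg,
    lintegral_withDensity_eq_lintegral_mul _ (hgm.enorm.pow_const 2) (hfm.enorm.pow_const 2)]
  simp only [Pi.mul_apply, enorm_mul, mul_pow, mul_comm]

theorem val_val {f g : X → 𝕜} (hfm : Measurable f) (hgm : Measurable g) {x : H}
    (hg : MemLp g 2 (vecMeasure ρ x)) (hf : MemLp f 2 (vecMeasure ρ (val ρ g x))) :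
    val ρ f (val ρ g x) = val ρ (f * g) x := by
  obtain ⟨u, hu⟩ := exists_continuous_tendsto hf
  have h1 := tendsto_apply_of_le hu le_rfl hf
  have h2 : Tendsto (fun n => val ρ (⇑(u n) * g) x) atTop (𝓝 (val ρ (f * g) x)) := by
    refine tendsto_val (fun n => (apply_val_eq hg (u n)).1)
      ((memLp_val_iff hfm hgm hg).1 hf) ?_
    rw [tendsto_eLpNorm_two_iff] at hu ⊢
    refine hu.congr fun n => ?_
    rw [vecMeasure_val hgm hg, lintegral_withDensity_eq_lintegral_mul _ (hgm.enorm.pow_const 2)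
      (((u n).continuous.measurable.sub hfm).enorm.pow_const 2)]
    refine lintegral_congr fun a => ?_
    simp only [Pi.mul_apply, Pi.sub_apply]
    rw [← sub_mul, enorm_mul, mul_pow, mul_comm]
  refine tendsto_nhds_unique h1 (h2.congr fun n => ?_)
  exact (apply_val_eq hg (u n)).2.symm

theorem vecMeasure_univ_bound {f : X → 𝕜} (hf : Measurable f) {C : ℝ} (hC : ∀ a, ‖f a‖ ≤ C)
    (x : H) : ‖val ρ f x‖ ≤ |C| * ‖x‖ := by
  have h1 : ‖val ρ f x‖ₑ ≤ ‖ρ (((|C| : ℝ) : 𝕜) • (1 : C(X, 𝕜))) x‖ₑ := by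
    rw [enorm_val (memLp_of_bounded hf hC _), enorm_apply_eq_eLpNorm]
    refine eLpNorm_mono fun a => ?_
    change ‖f a‖ ≤ ‖((|C| : ℝ) : 𝕜) * 1‖
    rw [mul_one, RCLike.norm_ofReal, abs_abs]
    exact (hC a).trans (le_abs_self C)
  rw [map_smul, map_one, enorm_le_iff_norm_le] at h1
  refine h1.trans_eq ?_
  change ‖((|C| : ℝ) : 𝕜) • x‖ = _
  rw [norm_smul, RCLike.norm_ofReal, abs_abs]

variable (ρ) in
/-- `Φ(f)` as a bounded operator, for a bounded function `f`. -/
def borelCLM (f : X → 𝕜) (hf : Measurable f) (C : ℝ) (hC : ∀ a, ‖f a‖ ≤ C) : H →L[𝕜] H :=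
  LinearMap.mkContinuous
    { toFun := fun x => val ρ f x
      map_add' := fun _ _ =>
        val_add_right hf (memLp_of_bounded hf hC _) (memLp_of_bounded hf hC _)
      map_smul' := fun c _ => val_smul_right hf c (memLp_of_bounded hf hC _) }
    |C| fun x => vecMeasure_univ_bound hf hC x

theorem borelOp_eq_ofBounded {f : MeasFun X 𝕜} {C : ℝ} (hC : ∀ a, ‖f.1 a‖ ≤ C) :
    borelOp ρ f = ofBounded (borelCLM ρ f.1 f.2 C hC) := by
  refine eq_of_forall_mem_graph fun x y => ?_
  rw [mem_graph_borelOp, mem_graph_ofBounded]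
  exact ⟨fun h => h.2, fun h => ⟨memLp_of_bounded f.2 hC _, h⟩⟩

theorem inner_val_conj {f : X → 𝕜} (hf : Measurable f) {C : ℝ} (hC : ∀ a, ‖f a‖ ≤ C) (x y : H) :
    inner 𝕜 (val ρ f x) y = inner 𝕜 x (val ρ (fun a => (starRingEnd 𝕜) (f a)) y) := by
  have hcm : Measurable fun a => (starRingEnd 𝕜) (f a) :=
    RCLike.continuous_conj.measurable.comp hf
  have hcC : ∀ a, ‖(starRingEnd 𝕜) (f a)‖ ≤ C := fun a => by rw [RCLike.norm_conj]; exact hC a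
  obtain ⟨u, hu⟩ := exists_continuous_tendsto
    (memLp_of_bounded hf hC (vecMeasure ρ x + vecMeasure ρ y))
  have hu' : Tendsto (fun n => eLpNorm (⇑(star (u n)) - fun a => (starRingEnd 𝕜) (f a)) 2
      (vecMeasure ρ x + vecMeasure ρ y)) atTop (𝓝 0) := by
    refine hu.congr fun n => ?_
    refine eLpNorm_congr_norm_ae (ae_of_all _ fun a => ?_)
    change ‖u n a - f a‖ = ‖(starRingEnd 𝕜) (u n a) - (starRingEnd 𝕜) (f a)‖
    rw [← map_sub, RCLike.norm_conj]
  have h1 := tendsto_apply_of_le hu (Measure.le_add_right le_rfl)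
    (memLp_of_bounded hf hC (vecMeasure ρ x))
  have h2 := tendsto_apply_of_le hu' (Measure.le_add_left le_rfl)
    (memLp_of_bounded hcm hcC (vecMeasure ρ y))
  refine tendsto_nhds_unique (h1.inner tendsto_const_nhds)
    ((tendsto_const_nhds.inner h2).congr fun n => ?_)
  rw [map_star]
  exact ContinuousLinearMap.adjoint_inner_right (ρ (u n)) x y

omit [TopologicalSpace X] [CompactSpace X] [TopologicalSpace.MetrizableSpace X]
  [MeasurableSpace X] [BorelSpace X] in
theorem norm_indicator_one_le (s : Set X) (a : X) : ‖s.indicator (fun _ => (1 : 𝕜)) a‖ ≤ 1 := by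
  by_cases h : a ∈ s <;> simp [h]

omit [TopologicalSpace X] [CompactSpace X] [TopologicalSpace.MetrizableSpace X]
  [MeasurableSpace X] [BorelSpace X] in
theorem norm_indicator_le (f : X → 𝕜) (k : ℕ) (a : X) :
    ‖{b | ‖f b‖ ≤ k}.indicator f a‖ ≤ k := by
  by_cases h : ‖f a‖ ≤ k
  · rwa [Set.indicator_of_mem (show a ∈ {b | ‖f b‖ ≤ k} from h)]
  · rw [Set.indicator_of_notMem (show a ∉ {b | ‖f b‖ ≤ k} from h), norm_zero]
    exact Nat.cast_nonneg k

omit [TopologicalSpace X] [CompactSpace X] [TopologicalSpace.MetrizableSpace X]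
  [MeasurableSpace X] [BorelSpace X] in
theorem tendsto_indicator_norm_le (f g : X → 𝕜) (a : X) :
    Tendsto (fun k : ℕ => {b | ‖f b‖ ≤ k}.indicator g a) atTop (𝓝 (g a)) := by
  obtain ⟨N, hN⟩ := exists_nat_ge ‖f a‖
  refine tendsto_const_nhds.congr' ?_
  filter_upwards [eventually_ge_atTop N] with k hk
  rw [Set.indicator_of_mem]
  exact hN.trans (Nat.cast_le.2 hk)

/-- Let 1_k be the indicator of {|f| ≤ k}. If x_n → x and Φ(f)x_n → y, boundedness of the truncated
operators gives Φ(1_k)y = Φ(1_k f)x. Fatou's lemma then puts f in L²(μ_x), and k → ∞ gives y =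
Φ(f)x. -/
theorem isClosed_borelOp (f : MeasFun X 𝕜) : (borelOp ρ f).IsClosed := by
  obtain ⟨f, hf⟩ := f
  set h : ℕ → X → 𝕜 := fun k => {b | ‖f b‖ ≤ k}.indicator fun _ => 1 with hh
  set T : ℕ → X → 𝕜 := fun k => {b | ‖f b‖ ≤ k}.indicator f with hT
  have hs : ∀ k : ℕ, MeasurableSet {b | ‖f b‖ ≤ k} := fun k =>
    measurableSet_le hf.norm measurable_const
  have hhm : ∀ k, Measurable (h k) := fun k => measurable_const.indicator (hs k)
  have hTm : ∀ k, Measurable (T k) := fun k => hf.indicator (hs k)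
  have hhC : ∀ k a, ‖h k a‖ ≤ 1 := fun k a => norm_indicator_one_le _ a
  have hTC : ∀ (k : ℕ) a, ‖T k a‖ ≤ k := fun k a => norm_indicator_le f k a
  have hmul : ∀ k, h k * f = T k := fun k => by
    funext a
    by_cases ha : a ∈ {b | ‖f b‖ ≤ k} <;> simp [hh, hT, ha]
  refine IsSeqClosed.isClosed ?_
  rintro p ⟨x, y⟩ hp hlim
  have hx : Tendsto (fun n => (p n).1) atTop (𝓝 x) := (continuous_fst.tendsto _).comp hlim
  have hy : Tendsto (fun n => (p n).2) atTop (𝓝 y) := (continuous_snd.tendsto _).comp hlim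
  have hp' : ∀ n, MemLp f 2 (vecMeasure ρ (p n).1) ∧ (p n).2 = val ρ f (p n).1 := fun n =>
    mem_graph_borelOp.1 (hp n)
  have hkey : ∀ k, val ρ (h k) y = val ρ (T k) x := by
    intro k
    have h1 := ((borelCLM ρ (h k) (hhm k) 1 (hhC k)).continuous.tendsto y).comp hy
    have h2 := ((borelCLM ρ (T k) (hTm k) k (hTC k)).continuous.tendsto x).comp hx
    refine tendsto_nhds_unique h1 (h2.congr fun n => ?_)
    change val ρ (T k) (p n).1 = val ρ (h k) (p n).2
    rw [(hp' n).2, val_val (hhm k) hf (hp' n).1 (memLp_of_bounded (hhm k) (hhC k) _), hmul]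
  have hbd : ∀ k, ∫⁻ a, ‖T k a‖ₑ ^ 2 ∂vecMeasure ρ x ≤ ‖y‖ₑ ^ 2 := by
    intro k
    rw [← eLpNorm_two_sq, ← enorm_val (memLp_of_bounded (hTm k) (hTC k) _), ← hkey k]
    refine pow_le_pow_left' ?_ 2
    rw [enorm_le_iff_norm_le]
    simpa using vecMeasure_univ_bound (ρ := ρ) (hhm k) (hhC k) y
  have hTlim : ∀ a, Tendsto (fun k => T k a) atTop (𝓝 (f a)) := fun a =>
    tendsto_indicator_norm_le f f a
  have hTle : ∀ k a, ‖T k a‖ₑ ≤ ‖f a‖ₑ := fun k a => by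
    by_cases ha : a ∈ {b | ‖f b‖ ≤ k} <;> simp [hT, ha]
  have hmem : MemLp f 2 (vecMeasure ρ x) := by
    rw [memLp_two_iff hf]
    refine lt_of_le_of_lt ?_ (show ‖y‖ₑ ^ 2 < ∞ by simp)
    refine le_trans (lintegral_mono fun a => ?_) ((lintegral_liminf_le (u := atTop)
      fun k => (hTm k).enorm.pow_const 2).trans (liminf_le_of_le (by isBoundedDefault)
        fun b hb => ?_))
    · exact (ENNReal.Tendsto.pow (n := 2) (hTlim a).enorm).liminf_eq.ge
    · obtain ⟨k, hk⟩ := hb.exists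
      exact hk.trans (hbd k)
  have hlim1 : Tendsto (fun k => val ρ (T k) x) atTop (𝓝 (val ρ f x)) := by
    refine tendsto_val (fun k => memLp_of_bounded (hTm k) (hTC k) _) hmem ?_
    rw [tendsto_eLpNorm_two_iff]
    have h0 : (0 : ℝ≥0∞) = ∫⁻ _ : X, 0 ∂vecMeasure ρ x := by simp
    rw [h0]
    refine tendsto_lintegral_of_dominated_convergence (fun a => ‖f a‖ₑ ^ 2)
      (fun k => ((hTm k).sub hf).enorm.pow_const 2) (fun k => ae_of_all _ fun a => ?_)
      ((memLp_two_iff hf).1 hmem).ne (ae_of_all _ fun a => ?_)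
    · refine pow_le_pow_left' ?_ 2
      by_cases ha : a ∈ {b | ‖f b‖ ≤ k} <;> simp [hT, ha]
    · have h1 : Tendsto (fun k => T k a - f a) atTop (𝓝 0) := by
        simpa using (hTlim a).sub_const (f a)
      simpa using ENNReal.Tendsto.pow (n := 2) h1.enorm
  have hlim2 : Tendsto (fun k => val ρ (h k) y) atTop (𝓝 y) := by
    have h1 : val ρ (fun _ => (1 : 𝕜)) y = y := by
      have := val_continuous (ρ := ρ) 1 y
      rwa [map_one] at this
    nth_rewrite 2 [← h1]
    exact tendsto_val (fun k => memLp_of_bounded (hhm k) (hhC k) _) (memLp_const 1)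
      (tendsto_eLpNorm_two_of_bounded hhm measurable_const hhC
        fun a => tendsto_indicator_norm_le f _ a)
  refine mem_graph_borelOp.2 ⟨hmem, tendsto_nhds_unique hlim2 (hlim1.congr fun k => ?_)⟩
  exact (hkey k).symm

theorem isMeasurableCalculus_borelOp : IsMeasurableCalculus (borelOp ρ) where
  isClosed := isClosed_borelOp
  map_one := by
    refine eq_of_forall_mem_graph fun x y => ?_
    rw [mem_graph_borelOp, mem_graph_idOp]
    have h1 : val ρ (fun _ => (1 : 𝕜)) x = x := by
      have := val_continuous (ρ := ρ) 1 x
      rwa [map_one] at this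
    have h2 : MemLp (fun _ => (1 : 𝕜)) 2 (vecMeasure ρ x) := memLp_const 1
    simp only [h1, h2, true_and]
  map_add_le f g := le_of_forall_mem_graph fun x y h => by
    obtain ⟨u, v, hu, hv, rfl⟩ := mem_graph_add.1 h
    obtain ⟨hu', rfl⟩ := mem_graph_borelOp.1 hu
    obtain ⟨hv', rfl⟩ := mem_graph_borelOp.1 hv
    exact mem_graph_borelOp.2 ⟨hu'.add hv', (val_add hu' hv').symm⟩
  map_smul_le c f := le_of_forall_mem_graph fun x y h => by
    obtain ⟨u, hu, rfl⟩ := mem_graph_smul.1 h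
    obtain ⟨hu', rfl⟩ := mem_graph_borelOp.1 hu
    exact mem_graph_borelOp.2 ⟨hu'.const_smul c, (val_smul c hu').symm⟩
  map_mul_le f g := le_of_forall_mem_graph fun x y h => by
    obtain ⟨z, hz, hy⟩ := mem_graph_opComp.1 h
    obtain ⟨hz', rfl⟩ := mem_graph_borelOp.1 hz
    obtain ⟨hy', rfl⟩ := mem_graph_borelOp.1 hy
    exact mem_graph_borelOp.2 ⟨(memLp_val_iff f.2 g.2 hz').1 hy', val_val f.2 g.2 hz' hy'⟩
  domain_mul f g := by
    ext x
    rw [Submodule.mem_inf, LinearPMap.mem_domain_iff]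
    constructor
    · rintro ⟨y, h⟩
      obtain ⟨z, hz, hy⟩ := mem_graph_opComp.1 h
      obtain ⟨hz', rfl⟩ := mem_graph_borelOp.1 hz
      obtain ⟨hy', rfl⟩ := mem_graph_borelOp.1 hy
      exact ⟨hz', (memLp_val_iff f.2 g.2 hz').1 hy'⟩
    · rintro ⟨h1, h2⟩
      exact ⟨_, mem_graph_opComp.2 ⟨_, mem_graph_borelOp.2 ⟨h1, rfl⟩,
        mem_graph_borelOp.2 ⟨(memLp_val_iff f.2 g.2 h1).2 h2, rfl⟩⟩⟩
  map_bounded := by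
    rintro f ⟨C, hC⟩
    refine ⟨_, borelOp_eq_ofBounded hC, ?_⟩
    have hcC : ∀ a, ‖(starRingEnd 𝕜) (f.1 a)‖ ≤ C := fun a => by
      rw [RCLike.norm_conj]; exact hC a
    rw [borelOp_eq_ofBounded (f := ⟨fun a => (starRingEnd 𝕜) (f.1 a), _⟩) hcC]
    congr 1
    refine (ContinuousLinearMap.eq_adjoint_iff _ _).2 fun x y => ?_
    have := inner_val_conj (ρ := ρ) (RCLike.continuous_conj.measurable.comp f.2) hcC x y
    simp only [Function.comp_apply, RCLike.conj_conj] at this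
    exact this
  weak_bp_continuous := by
    rintro f g ⟨C, hC⟩ hlim B L hB hL u v
    have hgC : ∀ x, ‖g.1 x‖ ≤ C := fun x => le_of_tendsto' (hlim x).norm fun n => hC n x
    have h1 : ∀ n, B n u = val ρ (f n).1 u := fun n =>
      (mem_graph_borelOp.1 (hB n ▸ mem_graph_ofBounded.2 rfl : (u, B n u) ∈ _)).2
    have h2 : L u = val ρ g.1 u :=
      (mem_graph_borelOp.1 (hL ▸ mem_graph_ofBounded.2 rfl : (u, L u) ∈ _)).2
    simp only [h1, h2]
    refine tendsto_const_nhds.inner (tendsto_val (fun n => memLp_of_bounded (f n).2 (hC n) _)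
      (memLp_of_bounded g.2 hgC _) ?_)
    exact tendsto_eLpNorm_two_of_bounded (fun n => (f n).2) g.2 hC hlim

end UnboundedCalculus

/-! ### Consequences of the axioms of a measurable calculus -/

section AbstractCalculus

variable {X Y 𝕜 H : Type*} [MeasurableSpace X] [MeasurableSpace Y] [RCLike 𝕜]
  [NormedAddCommGroup H] [InnerProductSpace 𝕜 H] [CompleteSpace H]

omit [CompleteSpace H] in
theorem eq_ofBounded_of_forall {A : H →ₗ.[𝕜] H} {B : H →L[𝕜] H}
    (h : ∀ x, (x, B x) ∈ A.graph) : A = ofBounded B := by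
  refine eq_of_forall_mem_graph fun x y => ?_
  rw [mem_graph_ofBounded]
  constructor
  · exact fun hxy => A.mem_graph_snd_inj hxy (h x) rfl
  · rintro rfl
    exact h x

omit [CompleteSpace H] in
theorem mem_graph_of_eq_ofBounded {A : H →ₗ.[𝕜] H} {B : H →L[𝕜] H} (h : A = ofBounded B) (x : H) :
    (x, B x) ∈ A.graph := by
  rw [h, mem_graph_ofBounded]

/-- The indicator function of a measurable set. -/
def indFun (𝕜 : Type*) [RCLike 𝕜] {s : Set X} (hs : MeasurableSet s) : MeasFun X 𝕜 :=
  ⟨s.indicator fun _ => 1, measurable_const.indicator hs⟩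

theorem norm_indFun_le {s : Set X} (hs : MeasurableSet s) (a : X) : ‖(indFun 𝕜 hs).1 a‖ ≤ 1 :=
  norm_indicator_one_le s a

namespace IsMeasurableCalculus

variable {Φ Ψ : MeasFun X 𝕜 → H →ₗ.[𝕜] H} (h : IsMeasurableCalculus Φ)
  (h' : IsMeasurableCalculus Ψ)
include h

theorem mem_graph_mul {f g k : MeasFun X 𝕜} (hk : ∀ a, k.1 a = f.1 a * g.1 a) {x y z : H}
    (hz : (x, z) ∈ (Φ g).graph) (hy : (z, y) ∈ (Φ f).graph) : (x, y) ∈ (Φ k).graph := by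
  obtain rfl : k = ⟨fun a => f.1 a * g.1 a, f.2.mul g.2⟩ := Subtype.ext (funext hk)
  exact mem_graph_of_le (h.map_mul_le f g) (mem_graph_opComp.2 ⟨z, hz, hy⟩)

/-- This is the domain axiom read backwards: x in the domains of Φ(g) and Φ(fg) forces Φ(g)x into
the domain of Φ(f). It produces elements of unbounded graphs from bounded functions. -/
theorem mem_graph_of_mul {f g k : MeasFun X 𝕜} (hk : ∀ a, k.1 a = f.1 a * g.1 a) {x y z : H}
    (hz : (x, z) ∈ (Φ g).graph) (hy : (x, y) ∈ (Φ k).graph) : (z, y) ∈ (Φ f).graph := by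
  obtain rfl : k = ⟨fun a => f.1 a * g.1 a, f.2.mul g.2⟩ := Subtype.ext (funext hk)
  have hdom : x ∈ (opComp (Φ f) (Φ g)).domain := by
    rw [h.domain_mul]
    exact ⟨LinearPMap.mem_domain_of_mem_graph hz, LinearPMap.mem_domain_of_mem_graph hy⟩
  obtain ⟨w, hw⟩ := LinearPMap.mem_domain_iff.1 hdom
  obtain ⟨z', hz', hw'⟩ := mem_graph_opComp.1 hw
  obtain rfl := (Φ g).mem_graph_snd_inj hz' hz rfl
  have := mem_graph_of_le (h.map_mul_le f g) hw
  obtain rfl := LinearPMap.mem_graph_snd_inj _ this hy rfl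
  exact hw'

theorem eq_mul {f g k : MeasFun X 𝕜} (hk : ∀ a, k.1 a = f.1 a * g.1 a) {B C : H →L[𝕜] H}
    (hf : Φ f = ofBounded B) (hg : Φ g = ofBounded C) : Φ k = ofBounded (B * C) :=
  eq_ofBounded_of_forall fun x => h.mem_graph_mul hk (mem_graph_of_eq_ofBounded hg x)
    (mem_graph_of_eq_ofBounded hf (C x))

theorem eq_add {f g k : MeasFun X 𝕜} (hk : ∀ a, k.1 a = f.1 a + g.1 a) {B C : H →L[𝕜] H}
    (hf : Φ f = ofBounded B) (hg : Φ g = ofBounded C) : Φ k = ofBounded (B + C) := by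
  obtain rfl : k = ⟨fun a => f.1 a + g.1 a, f.2.add g.2⟩ := Subtype.ext (funext hk)
  exact eq_ofBounded_of_forall fun x => mem_graph_of_le (h.map_add_le f g)
    (mem_graph_add.2 ⟨_, _, mem_graph_of_eq_ofBounded hf x, mem_graph_of_eq_ofBounded hg x, rfl⟩)

theorem eq_smul {f k : MeasFun X 𝕜} {c : 𝕜} (hk : ∀ a, k.1 a = c * f.1 a) {B : H →L[𝕜] H}
    (hf : Φ f = ofBounded B) : Φ k = ofBounded (c • B) := by
  obtain rfl : k = ⟨fun a => c * f.1 a, f.2.const_mul c⟩ := Subtype.ext (funext hk)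
  exact eq_ofBounded_of_forall fun x => mem_graph_of_le (h.map_smul_le c f)
    (mem_graph_smul.2 ⟨_, mem_graph_of_eq_ofBounded hf x, rfl⟩)

theorem eq_const {k : MeasFun X 𝕜} {c : 𝕜} (hk : ∀ a, k.1 a = c) :
    Φ k = ofBounded (c • 1) :=
  h.eq_smul (f := ⟨fun _ => 1, measurable_const⟩) (by simpa using hk) h.map_one

theorem exists_eq_ofBounded (f : MeasFun X 𝕜) {C : ℝ} (hC : ∀ a, ‖f.1 a‖ ≤ C) :
    ∃ B : H →L[𝕜] H, Φ f = ofBounded B :=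
  (h.map_bounded f ⟨C, hC⟩).imp fun _ hB => hB.1

theorem eq_star {f k : MeasFun X 𝕜} (hk : ∀ a, k.1 a = (starRingEnd 𝕜) (f.1 a)) {C : ℝ}
    (hC : ∀ a, ‖f.1 a‖ ≤ C) {B : H →L[𝕜] H} (hf : Φ f = ofBounded B) :
    Φ k = ofBounded (star B) := by
  obtain rfl : k = ⟨fun a => (starRingEnd 𝕜) (f.1 a),
    RCLike.continuous_conj.measurable.comp f.2⟩ := Subtype.ext (funext hk)
  obtain ⟨B', h1, h2⟩ := h.map_bounded f ⟨C, hC⟩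
  obtain rfl := ofBounded_injective (hf.symm.trans h1)
  exact h2

theorem isSelfAdjoint_of_real {f : MeasFun X 𝕜} (hk : ∀ a, (starRingEnd 𝕜) (f.1 a) = f.1 a) {C : ℝ}
    (hC : ∀ a, ‖f.1 a‖ ≤ C) {B : H →L[𝕜] H} (hf : Φ f = ofBounded B) : IsSelfAdjoint B :=
  ofBounded_injective ((h.eq_star (fun a => (hk a).symm) hC hf).symm.trans hf)

/-- The pushforward of a measurable calculus along a measurable map. -/
theorem comap {θ : X → Y} (hθ : Measurable θ) :
    IsMeasurableCalculus fun f : MeasFun Y 𝕜 => Φ ⟨fun a => f.1 (θ a), f.2.comp hθ⟩ where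
  isClosed _ := h.isClosed _
  map_one := h.map_one
  map_add_le f g := h.map_add_le ⟨fun a => f.1 (θ a), f.2.comp hθ⟩ ⟨fun a => g.1 (θ a), g.2.comp hθ⟩
  map_smul_le c f := h.map_smul_le c ⟨fun a => f.1 (θ a), f.2.comp hθ⟩
  map_mul_le f g := h.map_mul_le ⟨fun a => f.1 (θ a), f.2.comp hθ⟩ ⟨fun a => g.1 (θ a), g.2.comp hθ⟩
  domain_mul f g := h.domain_mul ⟨fun a => f.1 (θ a), f.2.comp hθ⟩ ⟨fun a => g.1 (θ a), g.2.comp hθ⟩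
  map_bounded f hf := h.map_bounded ⟨fun a => f.1 (θ a), f.2.comp hθ⟩
    (hf.imp fun _ hC a => hC (θ a))
  weak_bp_continuous f g hf hlim B L hB hL :=
    h.weak_bp_continuous (fun n => ⟨fun a => (f n).1 (θ a), (f n).2.comp hθ⟩)
      ⟨fun a => g.1 (θ a), g.2.comp hθ⟩ (hf.imp fun _ hC n a => hC n (θ a))
      (fun a => hlim (θ a)) B L hB hL

/-- Spectral projections that tend to the identity weakly do so strongly. -/
theorem tendsto_of_indFun {E : ℕ → Set X} (hE : ∀ n, MeasurableSet (E n)) {B : ℕ → H →L[𝕜] H}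
    (hB : ∀ n, Φ (indFun 𝕜 (hE n)) = ofBounded (B n)) {g : MeasFun X 𝕜} (hg : Φ g = idOp 𝕜 H)
    (hlim : ∀ a, Tendsto (fun n => (indFun 𝕜 (hE n)).1 a) atTop (𝓝 (g.1 a))) (x : H) :
    Tendsto (fun n => B n x) atTop (𝓝 x) := by
  have hweak := h.weak_bp_continuous (fun n => indFun 𝕜 (hE n)) g
    ⟨1, fun n a => norm_indFun_le (hE n) a⟩ hlim B _ hB hg x x
  -- Each B n is an orthogonal projection, so ‖B n x‖² = ⟨x, B n x⟩ and weak convergence controls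
  -- the norm.
  have hnorm : ∀ n, ‖B n x - x‖ ^ 2 = ‖x‖ ^ 2 - RCLike.re (inner 𝕜 x (B n x)) := by
    intro n
    have hsa : IsSelfAdjoint (B n) := h.isSelfAdjoint_of_real (f := indFun 𝕜 (hE n)) (fun a => by
      by_cases ha : a ∈ E n <;> simp [indFun, ha]) (norm_indFun_le (hE n)) (hB n)
    have hid : B n * B n = B n := ofBounded_injective
      ((h.eq_mul (f := indFun 𝕜 (hE n)) (g := indFun 𝕜 (hE n)) (k := indFun 𝕜 (hE n)) (fun a => by
        by_cases ha : a ∈ E n <;> simp [indFun, ha]) (hB n) (hB n)).symm.trans (hB n))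
    have hsym := ContinuousLinearMap.isSelfAdjoint_iff_isSymmetric.1 hsa
    have h1 : inner 𝕜 (B n x) (B n x) = inner 𝕜 x (B n x) := by
      have h2 : inner 𝕜 (B n x) (B n x) = inner 𝕜 x (B n (B n x)) := hsym x (B n x)
      rw [h2]
      exact congrArg (fun C : H →L[𝕜] H => inner 𝕜 x (C x)) hid
    rw [@norm_sub_sq 𝕜, ← @inner_self_eq_norm_sq 𝕜 _ _ _ _ (B n x), h1, inner_re_symm (B n x) x]
    ring
  rw [tendsto_iff_norm_sub_tendsto_zero]
  have h3 : Tendsto (fun n => ‖B n x - x‖ ^ 2) atTop (𝓝 0) := by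
    simp only [hnorm]
    have h4 := (RCLike.continuous_re.tendsto _).comp hweak
    have h5 := tendsto_const_nhds (x := ‖x‖ ^ 2) |>.sub h4
    simp only [ContinuousLinearMap.coe_id', id_eq, inner_self_eq_norm_sq, sub_self] at h5
    exact h5
  have h6 := h3.sqrt
  simpa only [Real.sqrt_sq (norm_nonneg _), Real.sqrt_zero] using h6

/-- If spectral projections tend to the identity, then their ranges span a core of `Φ(z)`. -/
theorem le_of_indFun (z : MeasFun X 𝕜) {E : ℕ → Set X} (hE : ∀ n, MeasurableSet (E n))
    {B : ℕ → H →L[𝕜] H} (hB : ∀ n, Φ (indFun 𝕜 (hE n)) = ofBounded (B n))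
    (hlim : ∀ x, Tendsto (fun n => B n x) atTop (𝓝 x)) {A : H →ₗ.[𝕜] H} (hA : A.IsClosed)
    (hle : ∀ n x y, (B n x, y) ∈ (Φ z).graph → (B n x, y) ∈ A.graph) : Φ z ≤ A := by
  refine le_of_forall_mem_graph fun x y hxy => ?_
  refine mem_graph_of_tendsto hA (fun n => hle n x (B n y) ?_) (hlim x) (hlim y)
  let k : MeasFun X 𝕜 := ⟨fun a => z.1 a * (indFun 𝕜 (hE n)).1 a, z.2.mul (indFun 𝕜 (hE n)).2⟩
  -- Reading z·1_E as 1_E·z shows that Φ(z) maps B n x to B n y.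
  have h1 : (x, B n y) ∈ (Φ k).graph := h.mem_graph_mul (k := k) (f := indFun 𝕜 (hE n))
    (g := z) (fun a => mul_comm _ _) hxy (mem_graph_of_eq_ofBounded (hB n) y)
  exact h.mem_graph_of_mul (k := k) (fun a => rfl) (mem_graph_of_eq_ofBounded (hB n) x) h1

-- Truncation to {|f| ≤ n}: on the ranges of these spectral projections Φ(f) is given by bounded
-- functions, and these ranges span a core.
include h' in
theorem le_of_agree_on_bounded
    (hagree : ∀ (f : MeasFun X 𝕜) (C : ℝ), (∀ a, ‖f.1 a‖ ≤ C) → Φ f = Ψ f) (f : MeasFun X 𝕜) :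
    Φ f ≤ Ψ f := by
  have hE : ∀ n : ℕ, MeasurableSet {a | ‖f.1 a‖ ≤ n} := fun n =>
    measurableSet_le f.2.norm measurable_const
  choose B hB using fun n => h.exists_eq_ofBounded (indFun 𝕜 (hE n)) (norm_indFun_le (hE n))
  refine h.le_of_indFun f hE hB (fun x => ?_) (h'.isClosed f) fun n x y hxy => ?_
  · exact h.tendsto_of_indFun hE hB h.map_one (fun a => tendsto_indicator_norm_le f.1 _ a) x
  · let k : MeasFun X 𝕜 := ⟨{a | ‖f.1 a‖ ≤ n}.indicator f.1, f.2.indicator (hE n)⟩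
    have hkC : ∀ a, ‖k.1 a‖ ≤ n := fun a => norm_indicator_le f.1 n a
    have hk : ∀ a, k.1 a = f.1 a * (indFun 𝕜 (hE n)).1 a := fun a => by
      by_cases ha : a ∈ {a | ‖f.1 a‖ ≤ n} <;> simp [k, indFun, ha]
    obtain ⟨F, hF⟩ := h.exists_eq_ofBounded k hkC
    have h1 := h.mem_graph_of_mul hk (mem_graph_of_eq_ofBounded (hB n) x)
      (mem_graph_of_eq_ofBounded hF x)
    have hB' := (hagree _ 1 (norm_indFun_le (hE n))).symm.trans (hB n)
    have hF' := (hagree _ n hkC).symm.trans hF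
    have h2 := h'.mem_graph_of_mul hk (mem_graph_of_eq_ofBounded hB' x)
      (mem_graph_of_eq_ofBounded hF' x)
    obtain rfl := (Φ f).mem_graph_snd_inj hxy h1 rfl
    exact h2

include h' in
theorem eq_of_agree_on_bounded
    (hagree : ∀ (f : MeasFun X 𝕜) (C : ℝ), (∀ a, ‖f.1 a‖ ≤ C) → Φ f = Ψ f) : Φ = Ψ :=
  funext fun f => le_antisymm (h.le_of_agree_on_bounded h' hagree f)
    (h'.le_of_agree_on_bounded h (fun g C hC => (hagree g C hC).symm) f)

/-- An operator is recovered from its bounded transform as `A = Φ(s / t)`. -/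
theorem eq_of_isBoundedTransform {A : H →ₗ.[𝕜] H} {T S : H →L[𝕜] H}
    (hA : IsBoundedTransform A T S) {t s z : MeasFun X 𝕜} (ht : Φ t = ofBounded T)
    (hs : Φ s = ofBounded S) (hz : ∀ a, z.1 a = s.1 a / t.1 a) : Φ z = A := by
  have hN : MeasurableSet {a | t.1 a = 0} := measurableSet_eq_fun t.2 measurable_const
  obtain ⟨P, hP⟩ := h.exists_eq_ofBounded (indFun 𝕜 hN) (norm_indFun_le hN)
  -- T P = Φ(t·1_{t=0}) = 0 and T is injective, so {t = 0} is spectrally null and the value of s/t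
  -- there is immaterial.
  have hP0 : P = 0 := by
    have h1 := h.eq_mul (k := ⟨fun _ => 0, measurable_const⟩) (fun a => by
      by_cases ha : a ∈ {a | t.1 a = 0}
      · simp [show t.1 a = 0 from ha]
      · simp [indFun, ha]) ht hP
    have h2 := h.eq_const (k := ⟨fun _ => 0, measurable_const⟩) (c := 0) fun _ => rfl
    have h3 := ofBounded_injective (h1.symm.trans h2)
    ext x
    refine hA.injective ?_
    have h4 := DFunLike.congr_fun h3 x
    rw [zero_smul] at h4
    exact h4.trans (map_zero T).symm
  have hN1 : Φ (indFun 𝕜 hN.compl) = idOp 𝕜 H := by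
    have h1 := h.eq_smul (c := -1) (f := indFun 𝕜 hN)
      (k := ⟨fun a => -1 * (indFun 𝕜 hN).1 a, (indFun 𝕜 hN).2.const_mul _⟩) (fun a => rfl) hP
    have h2 := h.eq_add (k := indFun 𝕜 hN.compl) (fun a => by
      by_cases ha : a ∈ {a | t.1 a = 0} <;> simp [indFun, ha]) h.map_one h1
    rw [h2, hP0, smul_zero, add_zero]
    rfl
  have hTS : ∀ x, (T x, S x) ∈ (Φ z).graph := by
    intro x
    -- Where t = 0 the product (s/t)·t is 0 and not s, so s is first cut off there; this does not
    -- change the operator.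
    let k : MeasFun X 𝕜 := ⟨fun a => s.1 a * (indFun 𝕜 hN.compl).1 a,
      s.2.mul (indFun 𝕜 hN.compl).2⟩
    have hk : Φ k = ofBounded S := (h.eq_mul (fun a => rfl) hs hN1).trans (by
      congr 1)
    refine h.mem_graph_of_mul (k := k) (g := t) (fun a => ?_) (mem_graph_of_eq_ofBounded ht x)
      (mem_graph_of_eq_ofBounded hk x)
    by_cases ha : t.1 a = 0
    · simp [k, indFun, hz, ha]
    · simp [k, indFun, hz, ha]
  refine le_antisymm ?_ (hA.le_of_isClosed (h.isClosed z) hTS)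
  have hpos : ∀ n : ℕ, (0 : ℝ) < (n + 1 : ℝ)⁻¹ := fun n => by positivity
  -- On these sets 1/t is bounded, so the spectral projection factors as T R and its range lies in
  -- the range of T, where Φ(z) and A agree.
  have hE : ∀ n : ℕ, MeasurableSet {a | (n + 1 : ℝ)⁻¹ ≤ ‖t.1 a‖} := fun n =>
    measurableSet_le measurable_const t.2.norm
  choose B hB using fun n => h.exists_eq_ofBounded (indFun 𝕜 (hE n)) (norm_indFun_le (hE n))
  refine h.le_of_indFun z hE hB (fun x => ?_) hA.isClosed fun n x y hxy => ?_
  · refine h.tendsto_of_indFun hE hB hN1 (fun a => ?_) x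
    by_cases ha : t.1 a = 0
    · have h1 : ∀ n : ℕ, a ∉ {a | (n + 1 : ℝ)⁻¹ ≤ ‖t.1 a‖} := fun n hn => by
        have : (n + 1 : ℝ)⁻¹ ≤ ‖t.1 a‖ := hn
        rw [ha, norm_zero] at this
        exact absurd this (not_le.2 (hpos n))
      simp [indFun, h1, ha]
    · obtain ⟨N, hN⟩ := exists_nat_one_div_lt (norm_pos_iff.2 ha)
      refine tendsto_const_nhds.congr' ?_
      filter_upwards [eventually_ge_atTop N] with n hn
      have h1 : a ∈ {a | (n + 1 : ℝ)⁻¹ ≤ ‖t.1 a‖} := by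
        refine le_trans ?_ hN.le
        rw [one_div]
        gcongr
      simp [indFun, h1, ha]
  · let r : MeasFun X 𝕜 := ⟨{a | (n + 1 : ℝ)⁻¹ ≤ ‖t.1 a‖}.indicator fun a => (t.1 a)⁻¹,
      t.2.inv.indicator (hE n)⟩
    obtain ⟨R, hR⟩ := h.exists_eq_ofBounded r (C := n + 1) fun a => by
      by_cases ha : a ∈ {a | (n + 1 : ℝ)⁻¹ ≤ ‖t.1 a‖}
      · rw [show r.1 a = (t.1 a)⁻¹ from Set.indicator_of_mem ha fun a => (t.1 a)⁻¹, norm_inv]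
        exact inv_le_of_inv_le₀ (by positivity) ha
      · rw [show r.1 a = 0 from Set.indicator_of_notMem ha fun a => (t.1 a)⁻¹, norm_zero]
        positivity
    have h1 := h.eq_mul (k := indFun 𝕜 (hE n)) (fun a => by
      by_cases ha : a ∈ {a | (n + 1 : ℝ)⁻¹ ≤ ‖t.1 a‖}
      · have h0 : t.1 a ≠ 0 := norm_pos_iff.1 ((hpos n).trans_le ha)
        simp [indFun, r, ha, h0]
      · simp [indFun, r, ha]) ht hR
    obtain h2 : B n = T * R := ofBounded_injective ((hB n).symm.trans h1)
    rw [h2] at hxy ⊢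
    obtain rfl := (Φ z).mem_graph_snd_inj hxy (hTS (R x)) rfl
    exact hA.mem_graph (R x)

/-- The bounded transform of `Φ(z)` is given by `1 / (1 + |z|²)` and `z / (1 + |z|²)`. -/
theorem eq_boundedTransform {z t s : MeasFun X 𝕜} {T S : H →L[𝕜] H}
    (hA : IsBoundedTransform (Φ z) T S) (ht : ∀ a, t.1 a = ((1 + ‖z.1 a‖ ^ 2)⁻¹ : ℝ))
    (hs : ∀ a, s.1 a = z.1 a * t.1 a) (htC : ∀ a, ‖t.1 a‖ ≤ 1) (hsC : ∀ a, ‖s.1 a‖ ≤ 1) :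
    Φ t = ofBounded T ∧ Φ s = ofBounded S := by
  obtain ⟨P, hP⟩ := h.exists_eq_ofBounded t htC
  obtain ⟨Q, hQ⟩ := h.exists_eq_ofBounded s hsC
  have hPsa : IsSelfAdjoint P := h.isSelfAdjoint_of_real (fun a => by
    rw [ht, RCLike.conj_ofReal]) htC hP
  have h1 : ∀ x, (P x, Q x) ∈ (Φ z).graph := fun x =>
    h.mem_graph_of_mul hs (mem_graph_of_eq_ofBounded hP x) (mem_graph_of_eq_ofBounded hQ x)
  let s' : MeasFun X 𝕜 := ⟨fun a => (starRingEnd 𝕜) (s.1 a),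
    RCLike.continuous_conj.measurable.comp s.2⟩
  have hs' : Φ s' = ofBounded (star Q) := h.eq_star (fun _ => rfl) hsC hQ
  let k : MeasFun X 𝕜 := ⟨fun a => s'.1 a * z.1 a, s'.2.mul z.2⟩
  -- The scalar identity behind this is conj(s)·z = |z|²/(1 + |z|²) = 1 - t.
  have hk : Φ k = ofBounded ((1 : 𝕜) • 1 + (-1 : 𝕜) • P) := by
    refine h.eq_add (f := ⟨fun _ => 1, measurable_const⟩)
      (g := ⟨fun a => -1 * t.1 a, t.2.const_mul _⟩) (fun a => ?_)
      (h.eq_const fun _ => rfl) (h.eq_smul (fun a => rfl) hP)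
    change (starRingEnd 𝕜) (s.1 a) * z.1 a = 1 + -1 * t.1 a
    have hne : (1 + ‖z.1 a‖ ^ 2 : ℝ) ≠ 0 := by positivity
    have e1 : (starRingEnd 𝕜) (s.1 a) * z.1 a = ((‖z.1 a‖ ^ 2 * (1 + ‖z.1 a‖ ^ 2)⁻¹ : ℝ) : 𝕜) := by
      rw [hs, map_mul, ht, RCLike.conj_ofReal, mul_right_comm, RCLike.conj_mul,
        RCLike.ofReal_mul, RCLike.ofReal_pow]
    have e2 : (‖z.1 a‖ ^ 2 * (1 + ‖z.1 a‖ ^ 2)⁻¹ : ℝ) = 1 + -1 * (1 + ‖z.1 a‖ ^ 2)⁻¹ := by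
      field_simp
      ring
    rw [e1, e2, ht]
    push_cast
    ring
  -- For b = Φ(z)a that identity gives Q*b = a - Pa, hence ⟨b, Qx⟩ = ⟨a, x - Px⟩. Then `unique`
  -- identifies P with T and Q with S.
  have h2 : ∀ x, (Q x, x - P x) ∈ (Φ z).adjoint.graph := by
    intro x
    rw [mem_graph_adjoint hA.dense_domain]
    intro a b hab
    have h3 := h.mem_graph_mul (k := k) (fun _ => rfl) hab (mem_graph_of_eq_ofBounded hs' b)
    rw [hk, mem_graph_ofBounded] at h3
    have h4 : inner 𝕜 (star Q b) x = inner 𝕜 b (Q x) :=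
      ContinuousLinearMap.adjoint_inner_left Q x b
    rw [← h4, h3]
    have h5 : inner 𝕜 (P a) x = inner 𝕜 a (P x) :=
      ContinuousLinearMap.isSelfAdjoint_iff_isSymmetric.1 hPsa a x
    simp [inner_add_left, inner_add_right, h5, sub_eq_add_neg]
  have h6 : ∀ x, P x = T x ∧ Q x = S x := fun x => by
    have := hA.unique (h1 x) (h2 x)
    rwa [add_sub_cancel] at this
  obtain rfl : P = T := ContinuousLinearMap.ext fun x => (h6 x).1
  obtain rfl : Q = S := ContinuousLinearMap.ext fun x => (h6 x).2
  exact ⟨hP, hQ⟩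

end IsMeasurableCalculus

end AbstractCalculus

/-! ### Agreement of two calculi -/

section Uniqueness

variable {X 𝕜 H : Type*} [MeasurableSpace X] [RCLike 𝕜]
  [NormedAddCommGroup H] [InnerProductSpace 𝕜 H] [CompleteSpace H]

/-- `f` is sent to the same bounded operator by `Φ` and `Ψ`. -/
def AgreeAt (Φ Ψ : MeasFun X 𝕜 → H →ₗ.[𝕜] H) (f : X → 𝕜) : Prop :=
  ∃ (hf : Measurable f) (B : H →L[𝕜] H), Φ ⟨f, hf⟩ = ofBounded B ∧ Ψ ⟨f, hf⟩ = ofBounded B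

namespace AgreeAt

variable {Φ Ψ : MeasFun X 𝕜 → H →ₗ.[𝕜] H} (h : IsMeasurableCalculus Φ)
  (h' : IsMeasurableCalculus Ψ)
include h h'

theorem add {f g : X → 𝕜} (hf : AgreeAt Φ Ψ f) (hg : AgreeAt Φ Ψ g) : AgreeAt Φ Ψ (f + g) := by
  obtain ⟨hfm, B, h1, h2⟩ := hf
  obtain ⟨hgm, C, h3, h4⟩ := hg
  exact ⟨hfm.add hgm, B + C, h.eq_add (fun _ => rfl) h1 h3, h'.eq_add (fun _ => rfl) h2 h4⟩

theorem mul {f g : X → 𝕜} (hf : AgreeAt Φ Ψ f) (hg : AgreeAt Φ Ψ g) : AgreeAt Φ Ψ (f * g) := by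
  obtain ⟨hfm, B, h1, h2⟩ := hf
  obtain ⟨hgm, C, h3, h4⟩ := hg
  exact ⟨hfm.mul hgm, B * C, h.eq_mul (fun _ => rfl) h1 h3, h'.eq_mul (fun _ => rfl) h2 h4⟩

theorem const (c : 𝕜) : AgreeAt Φ Ψ fun _ => c :=
  ⟨measurable_const, c • 1, h.eq_const fun _ => rfl, h'.eq_const fun _ => rfl⟩

theorem star {f : X → 𝕜} (hf : AgreeAt Φ Ψ f) {C : ℝ} (hC : ∀ a, ‖f a‖ ≤ C) :
    AgreeAt Φ Ψ fun a => (starRingEnd 𝕜) (f a) := by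
  obtain ⟨hfm, B, h1, h2⟩ := hf
  exact ⟨RCLike.continuous_conj.measurable.comp hfm, _, h.eq_star (fun _ => rfl) hC h1,
    h'.eq_star (fun _ => rfl) hC h2⟩

/-- Weak limits are unique, so agreement passes to bounded pointwise limits. -/
theorem of_tendsto {f : ℕ → X → 𝕜} {g : X → 𝕜} (hf : ∀ n, AgreeAt Φ Ψ (f n)) {C : ℝ}
    (hC : ∀ n a, ‖f n a‖ ≤ C) (hlim : ∀ a, Tendsto (fun n => f n a) atTop (𝓝 (g a))) :
    AgreeAt Φ Ψ g := by
  choose hfm B h1 h2 using hf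
  have hgm : Measurable g := measurable_of_tendsto_metrizable hfm (tendsto_pi_nhds.2 hlim)
  have hgC : ∀ a, ‖g a‖ ≤ C := fun a => le_of_tendsto' (hlim a).norm fun n => hC n a
  obtain ⟨L, hL⟩ := h.exists_eq_ofBounded ⟨g, hgm⟩ hgC
  obtain ⟨L', hL'⟩ := h'.exists_eq_ofBounded ⟨g, hgm⟩ hgC
  refine ⟨hgm, L, hL, ?_⟩
  have : L = L' := by
    ext u
    refine ext_inner_left 𝕜 fun v => ?_
    exact tendsto_nhds_unique
      (h.weak_bp_continuous (fun n => ⟨f n, hfm n⟩) ⟨g, hgm⟩ ⟨C, hC⟩ hlim B L h1 hL u v)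
      (h'.weak_bp_continuous (fun n => ⟨f n, hfm n⟩) ⟨g, hgm⟩ ⟨C, hC⟩ hlim B L' h2 hL' u v)
  rw [this, hL']

theorem of_indicator (hind : ∀ s : Set X, MeasurableSet s → AgreeAt Φ Ψ (s.indicator fun _ => 1))
    {f : X → 𝕜} (hf : Measurable f) {C : ℝ} (hC : ∀ a, ‖f a‖ ≤ C) : AgreeAt Φ Ψ f := by
  have hsimple : ∀ φ : MeasureTheory.SimpleFunc X 𝕜, AgreeAt Φ Ψ φ := by
    intro φ
    induction φ using MeasureTheory.SimpleFunc.induction with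
    | const c hs =>
      rename_i s
      have h1 := (const h h' c).mul h h' (hind s hs)
      have h2 : (fun _ : X => c) * (s.indicator fun _ => 1) = s.indicator (Function.const X c) := by
        funext a
        by_cases ha : a ∈ s <;> simp [ha]
      rw [h2] at h1
      simpa using h1
    | add _ hf hg => exact hf.add h h' hg
  have hsm : MeasureTheory.StronglyMeasurable f := hf.stronglyMeasurable
  obtain ⟨C', hC', hCC'⟩ : ∃ C' : ℝ, 0 ≤ C' ∧ C ≤ C' := ⟨max C 0, le_max_right _ _, le_max_left _ _⟩
  exact of_tendsto h h' (fun n => hsimple (hsm.approxBounded C' n))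
    (fun n a => hsm.norm_approxBounded_le hC' n a)
    fun a => hsm.tendsto_approxBounded_of_norm_le ((hC a).trans hCC')

end AgreeAt

variable {K : Type*} [TopologicalSpace K] [CompactSpace K] [TopologicalSpace.MetrizableSpace K]
  [MeasurableSpace K] [BorelSpace K] {Φ Ψ : MeasFun K 𝕜 → H →ₗ.[𝕜] H}

open scoped BoundedContinuousFunction NNReal

/-- Two calculi on a compact space that agree on enough continuous functions coincide. -/
theorem IsMeasurableCalculus.eq_of_separating (h : IsMeasurableCalculus Φ)
    (h' : IsMeasurableCalculus Ψ)
    (hsep : ∀ a b : K, a ≠ b → ∃ f : C(K, 𝕜), AgreeAt Φ Ψ f ∧ f a ≠ f b) : Φ = Ψ := by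
  -- Agreement is stable under the star algebra operations, so Stone–Weierstrass upgrades point
  -- separation to agreement on all of C(K).
  let 𝒮 : StarSubalgebra 𝕜 C(K, 𝕜) :=
    { carrier := {f | AgreeAt Φ Ψ f}
      mul_mem' := fun hf hg => hf.mul h h' hg
      add_mem' := fun hf hg => hf.add h h' hg
      algebraMap_mem' := fun c => AgreeAt.const h h' c
      star_mem' := fun {f} hf => hf.star h h' f.norm_coe_le_norm }
  have hdense : 𝒮.topologicalClosure = ⊤ := by
    refine ContinuousMap.starSubalgebra_topologicalClosure_eq_top_of_separatesPoints 𝒮 ?_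
    intro a b hab
    obtain ⟨f, hf, hne⟩ := hsep a b hab
    exact ⟨f, ⟨f, hf, rfl⟩, hne⟩
  have hcont : ∀ f : C(K, 𝕜), AgreeAt Φ Ψ f := by
    intro f
    have hf : f ∈ closure (𝒮 : Set C(K, 𝕜)) := by
      rw [← StarSubalgebra.topologicalClosure_coe, hdense]
      trivial
    obtain ⟨u, hu, hlim⟩ := mem_closure_iff_seq_limit.1 hf
    obtain ⟨C, hC⟩ := (Metric.isBounded_range_of_tendsto u hlim).exists_norm_le
    refine AgreeAt.of_tendsto h h' hu (C := C)
      (fun n a => ((u n).norm_coe_le_norm a).trans (hC _ ⟨n, rfl⟩)) fun a => ?_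
    exact ((continuous_eval_const a).tendsto f).comp hlim
  have hclosed : ∀ F : Set K, IsClosed F → AgreeAt Φ Ψ (F.indicator fun _ => 1) := by
    intro F hF
    refine AgreeAt.of_tendsto h h'
      (f := fun n a => (((hF.apprSeq n a : ℝ≥0) : ℝ) : 𝕜)) (C := 1) (fun n => ?_) (fun n a => ?_)
      fun a => ?_
    · exact hcont ⟨fun a => (((hF.apprSeq n a : ℝ≥0) : ℝ) : 𝕜), RCLike.continuous_ofReal.comp
        (NNReal.continuous_coe.comp (hF.apprSeq n).continuous)⟩
    · rw [RCLike.norm_ofReal, NNReal.abs_eq]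
      exact_mod_cast HasOuterApproxClosed.apprSeq_apply_le_one hF n a
    · have h1 := (tendsto_pi_nhds.1 (HasOuterApproxClosed.tendsto_apprSeq hF)) a
      have h2 := ((RCLike.continuous_ofReal (K := 𝕜)).comp NNReal.continuous_coe).tendsto _ |>.comp h1
      refine h2.congr' (Eventually.of_forall fun _ => rfl) |>.trans (le_of_eq ?_)
      by_cases ha : a ∈ F <;> simp [ha]
  -- Closed sets, whose indicators are bounded limits of continuous functions, form a π-system
  -- generating the Borel sets; the sets of agreement form a λ-system.
  have hind : ∀ s : Set K, MeasurableSet s → AgreeAt Φ Ψ (s.indicator fun _ => 1) := by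
    intro s hs
    induction s, hs using MeasurableSpace.induction_on_inter
      (BorelSpace.measurable_eq (α := K) |>.trans (borel_eq_generateFrom_isClosed))
      isPiSystem_isClosed with
    | empty => simpa using AgreeAt.const h h' 0
    | basic t ht => exact hclosed t ht
    | compl t htm ht =>
      have h1 := (AgreeAt.const h h' 1).add h h' ((AgreeAt.const h h' (-1)).mul h h' ht)
      convert h1 using 1
      funext a
      by_cases ha : a ∈ t <;> simp [ha]
    | iUnion f hd hfm hf =>
      have hpart : ∀ n, AgreeAt Φ Ψ ((⋃ i < n, f i).indicator fun _ => 1) := by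
        intro n
        induction n with
        | zero => simpa using AgreeAt.const h h' 0
        | succ n ih =>
          convert ih.add h h' (hf n) using 1
          rw [Set.biUnion_lt_succ, Set.indicator_union_of_disjoint]
          · rfl
          · simp only [Set.disjoint_iUnion_left]
            exact fun i hi => hd hi.ne
      refine AgreeAt.of_tendsto h h' hpart (C := 1) (fun n a => norm_indicator_one_le _ a)
        fun a => ?_
      by_cases ha : a ∈ ⋃ i, f i
      · obtain ⟨i, hi⟩ := Set.mem_iUnion.1 ha
        refine tendsto_const_nhds.congr' ?_
        filter_upwards [eventually_gt_atTop i] with n hn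
        rw [Set.indicator_of_mem ha, Set.indicator_of_mem]
        exact Set.mem_biUnion hn hi
      · refine tendsto_const_nhds.congr fun n => ?_
        rw [Set.indicator_of_notMem ha, Set.indicator_of_notMem]
        exact fun h1 => ha (Set.iUnion₂_subset_iUnion _ _ h1)
  refine h.eq_of_agree_on_bounded h' fun f C hC => ?_
  obtain ⟨_, B, h1, h2⟩ := AgreeAt.of_indicator h h' hind f.2 hC
  exact h1.trans h2.symm

end Uniqueness

/-! ### Existence and uniqueness for strongly commuting normal operators -/

variable {𝕜 H : Type*} [RCLike 𝕜] [NormedAddCommGroup H] [InnerProductSpace 𝕜 H]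
  [CompleteSpace H]

theorem exists_measurableCalculus {d : ℕ} {A : Fin d → H →ₗ.[𝕜] H}
    (hnormal : ∀ j, IsNormalOp (A j))
    (hreal : (RCLike.I : 𝕜) = 0 → ∀ j, IsSelfAdjoint (A j))
    (hcomm : ∀ j k, j ≠ k → StronglyCommute (A j) (A k)) :
    ∃ Φ : MeasFun (Fin d → 𝕜) 𝕜 → H →ₗ.[𝕜] H,
      IsMeasurableCalculus Φ ∧ ∀ j, Φ (coord 𝕜 j) = A j := by
  choose T S hTS using fun j =>
    exists_isBoundedTransform (hnormal j).dense_domain (hnormal j).isClosed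
  have hSreal : (RCLike.I : 𝕜) = 0 → ∀ j, IsSelfAdjoint (S j) := fun hI j =>
    (hTS j).isSelfAdjoint_right (hnormal j) (hreal hI j)
  have hT : ∀ j, star (T j) = T j := fun j => (hTS j).isSelfAdjoint_left.star_eq
  -- For j = k this is normality of A_j; for j ≠ k it is strong commutativity, with Fuglede
  -- supplying the adjoint.
  have hc : ∀ j k, Commute (T j) (T k) ∧ Commute (T j) (S k) ∧ Commute (S j) (S k) ∧
      Commute (S j) (star (S k)) := by
    intro j k
    by_cases hjk : j = k
    · subst hjk
      exact ⟨Commute.refl _, (hTS j).commute_of_normal (hnormal j), Commute.refl _,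
        ((hTS j).isStarNormal (hnormal j)).star_comm_self.symm⟩
    · obtain ⟨h1, h2, -, h4⟩ := (hcomm j k hjk).commute (hTS j) (hTS k)
      exact ⟨h1, h2, h4, (commute_adjoint_of_commute ((hTS k).isStarNormal (hnormal k))
        (fun hI => hSreal hI k) h4.symm).symm⟩
  obtain ⟨𝒜, hmet, ρ, n, -, hn⟩ := exists_continuousCalculus (Sum.elim T S)
    (by
      rintro (i | i) (j | j)
      · exact (hc i j).1
      · exact (hc i j).2.1
      · exact (hc j i).2.1.symm
      · exact (hc i j).2.2.1)
    (by
      rintro (i | i) (j | j)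
      · simpa [hT] using (hc i j).1
      · simpa [hT] using ((hc i j).2.1).star_star
      · simpa [hT] using ((hc j i).2.1).symm
      · exact (hc i j).2.2.2)
    (by
      rintro hI (i | i)
      · exact (hTS i).isSelfAdjoint_left
      · exact hSreal hI i)
  let _ : MeasurableSpace (charSpace 𝒜) := borel _
  have _ : BorelSpace (charSpace 𝒜) := ⟨rfl⟩
  have hΦ : IsMeasurableCalculus (borelOp ρ) := isMeasurableCalculus_borelOp
  have hcont : ∀ f : C(charSpace 𝒜, 𝕜), borelOp ρ ⟨f, f.continuous.measurable⟩ =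
      ofBounded (ρ f) := fun f => eq_ofBounded_of_forall fun x =>
    mem_graph_borelOp.2 ⟨memLp_continuous _ f, (val_continuous f x).symm⟩
  -- Formally A_j = S_j T_j⁻¹, so the joint spectral coordinate is s_j/t_j. It need not be
  -- continuous, but it is measurable.
  let θ : charSpace 𝒜 → Fin d → 𝕜 := fun a j => n (Sum.inr j) a / n (Sum.inl j) a
  have hθ : Measurable θ := measurable_pi_lambda _ fun j =>
    (n (Sum.inr j)).continuous.measurable.div (n (Sum.inl j)).continuous.measurable
  refine ⟨_, hΦ.comap hθ, fun j => ?_⟩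
  refine hΦ.eq_of_isBoundedTransform (hTS j) ((hcont (n (Sum.inl j))).trans ?_)
    ((hcont (n (Sum.inr j))).trans ?_) fun a => rfl
  · rw [hn]; rfl
  · rw [hn]; rfl

theorem norm_inv_one_add_sq_le (z : 𝕜) : ‖(((1 + ‖z‖ ^ 2)⁻¹ : ℝ) : 𝕜)‖ ≤ 1 := by
  rw [RCLike.norm_ofReal, abs_of_nonneg (by positivity)]
  exact inv_le_one_of_one_le₀ (by nlinarith [sq_nonneg ‖z‖])

theorem norm_mul_inv_one_add_sq_le (z : 𝕜) : ‖z * (((1 + ‖z‖ ^ 2)⁻¹ : ℝ) : 𝕜)‖ ≤ 1 := by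
  rw [norm_mul, RCLike.norm_ofReal, abs_of_nonneg (by positivity), ← div_eq_mul_inv,
    div_le_one (by positivity)]
  nlinarith [sq_nonneg (‖z‖ - 1)]

/-- The bounded transform `𝕜^d → (𝕜 × 𝕜)^d`, with values in the unit ball. -/
def boundedCoord (𝕜 : Type*) [RCLike 𝕜] (d : ℕ) (z : Fin d → 𝕜) :
    Metric.closedBall (0 : Fin d → 𝕜 × 𝕜) 1 :=
  ⟨fun j => ((((1 + ‖z j‖ ^ 2)⁻¹ : ℝ) : 𝕜), z j * (((1 + ‖z j‖ ^ 2)⁻¹ : ℝ) : 𝕜)), by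
    rw [mem_closedBall_zero_iff, pi_norm_le_iff_of_nonneg zero_le_one]
    exact fun j => max_le (norm_inv_one_add_sq_le _) (norm_mul_inv_one_add_sq_le _)⟩

theorem measurable_invOneAddSq {d : ℕ} (j : Fin d) :
    Measurable fun z : Fin d → 𝕜 => (((1 + ‖z j‖ ^ 2)⁻¹ : ℝ) : 𝕜) :=
  RCLike.continuous_ofReal.measurable.comp
    (((measurable_pi_apply j).norm.pow_const 2).const_add 1).inv

theorem measurable_boundedCoord (d : ℕ) : Measurable (boundedCoord 𝕜 d) :=
  (measurable_pi_lambda _ fun j => (measurable_invOneAddSq j).prodMk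
    ((measurable_pi_apply j).mul (measurable_invOneAddSq j))).subtype_mk

/-- Both calculi send the components of the bounded transform to T_j and S_j. Pushed forward to the
compact ball they agree on separating continuous functions, hence coincide there, and a measurable
left inverse of the embedding brings this back to 𝕜^d. -/
theorem IsMeasurableCalculus.eq_of_coord {d : ℕ} {A : Fin d → H →ₗ.[𝕜] H}
    (hnormal : ∀ j, IsNormalOp (A j)) {Φ Ψ : MeasFun (Fin d → 𝕜) 𝕜 → H →ₗ.[𝕜] H}
    (h : IsMeasurableCalculus Φ) (h' : IsMeasurableCalculus Ψ)
    (hA : ∀ j, Φ (coord 𝕜 j) = A j) (hA' : ∀ j, Ψ (coord 𝕜 j) = A j) : Φ = Ψ := by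
  choose T S hTS using fun j =>
    exists_isBoundedTransform (hnormal j).dense_domain (hnormal j).isClosed
  let K := Metric.closedBall (0 : Fin d → 𝕜 × 𝕜) 1
  have hK : CompactSpace K := isCompact_iff_compactSpace.1 (isCompact_closedBall _ _)
  have hκ := measurable_boundedCoord (𝕜 := 𝕜) d
  have htrans : ∀ {Ω : MeasFun (Fin d → 𝕜) 𝕜 → H →ₗ.[𝕜] H}, IsMeasurableCalculus Ω →
      (∀ j, Ω (coord 𝕜 j) = A j) → ∀ j,
      Ω ⟨_, measurable_invOneAddSq j⟩ = ofBounded (T j) ∧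
      Ω ⟨_, (measurable_pi_apply j).mul (measurable_invOneAddSq j)⟩ = ofBounded (S j) := by
    intro Ω hΩ hΩA j
    exact hΩ.eq_boundedTransform (z := coord 𝕜 j) (by rw [hΩA]; exact hTS j) (fun a => rfl)
      (fun a => rfl) (fun a => norm_inv_one_add_sq_le _) (fun a => norm_mul_inv_one_add_sq_le _)
  have key := (h.comap hκ).eq_of_separating (h'.comap hκ) fun a b hab => by
    obtain ⟨j, hj⟩ : ∃ j, a.1 j ≠ b.1 j := by
      by_contra! hne
      exact hab (Subtype.ext (funext hne))
    by_cases h1 : (a.1 j).1 = (b.1 j).1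
    · refine ⟨⟨fun k : K => (k.1 j).2,
        continuous_snd.comp ((continuous_apply j).comp continuous_subtype_val)⟩,
        ⟨ContinuousMap.measurable _, S j, ?_, ?_⟩,
        fun h2 => hj (Prod.ext h1 h2)⟩
      · exact (htrans h hA j).2
      · exact (htrans h' hA' j).2
    · refine ⟨⟨fun k : K => (k.1 j).1,
        continuous_fst.comp ((continuous_apply j).comp continuous_subtype_val)⟩,
        ⟨ContinuousMap.measurable _, T j, ?_, ?_⟩, h1⟩
      · exact (htrans h hA j).1
      · exact (htrans h' hA' j).1
  -- On the image of `boundedCoord` the first component never vanishes and division undoes the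
  -- transform; elsewhere only measurability of θ matters.
  let θ : K → Fin d → 𝕜 := fun k j => (k.1 j).2 / (k.1 j).1
  have hθ : Measurable θ := by
    refine measurable_pi_lambda _ fun j => ?_
    have := (measurable_pi_apply j).comp (measurable_subtype_coe : Measurable (Subtype.val : K → _))
    exact this.snd.div this.fst
  have hθκ : ∀ z, θ (boundedCoord 𝕜 d z) = z := by
    intro z
    funext j
    have : (((1 + ‖z j‖ ^ 2)⁻¹ : ℝ) : 𝕜) ≠ 0 := by
      have : ((1 + ‖z j‖ ^ 2)⁻¹ : ℝ) ≠ 0 := by positivity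
      exact_mod_cast this
    exact mul_div_cancel_right₀ _ this
  funext f
  have h1 := congrFun key ⟨fun k => f.1 (θ k), f.2.comp hθ⟩
  simp only [hθκ] at h1
  exact h1

end SpectralCalculus

end

theorem mainTheorem1 {𝕜 H : Type*} [RCLike 𝕜] [NormedAddCommGroup H] [InnerProductSpace 𝕜 H]
    [CompleteSpace H] (d : ℕ) (A : Fin d → H →ₗ.[𝕜] H)
    (hnormal : ∀ j, SpectralCalculus.IsNormalOp (A j))
    -- `RCLike.I = 0` says that the scalar field is the field of real numbers
    (hreal : (RCLike.I : 𝕜) = 0 → ∀ j, IsSelfAdjoint (A j))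
    (hcomm : ∀ j k, j ≠ k → SpectralCalculus.StronglyCommute (A j) (A k)) :
    ∃! Φ : SpectralCalculus.MeasFun (Fin d → 𝕜) 𝕜 → H →ₗ.[𝕜] H,
      SpectralCalculus.IsMeasurableCalculus Φ ∧
        ∀ j, Φ (SpectralCalculus.coord 𝕜 j) = A j := by
  obtain ⟨Φ, hΦ, hΦA⟩ := SpectralCalculus.exists_measurableCalculus hnormal hreal hcomm
  exact ⟨Φ, ⟨hΦ, hΦA⟩, fun Ψ hΨ => hΨ.1.eq_of_coord hnormal hΦ hΨ.2 hΦA⟩
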